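/- **Theorem.** Let $\mathcal A_n=\mathcal A_n^*\in\mathbb C^{p\times p}$ and let $\mathcal B_n\in\mathbb C^{p\times p}$ be invertible, $n\in\mathbb N_0$; put $\mathcal B_{-1}:=\mathbb O_p$. In $l^2(\mathbb N_0;\mathbb C^p)$ let $\mathcal A=\operatorname{diag}\{\mathcal A_0,\mathcal A_1,\dots\}$ be the block diagonal operator on its maximal domain, and let $\mathbf J$ be the minimal block Jacobi operator, i.e. the closure of the operator $f\mapsto(\mathcal B_{n-1}^*f_{n-1}+\mathcal A_nf_n+\mathcal B_nf_{n+1})_{n\ge 0}$ defined on the finite sequences $f$. Assume $\ker\mathcal A=\{0\}$. Write $$a_1(N)=\sup_{n\ge N}\big(\|\mathcal A_n^{-1}\mathcal B_n\|+\|\mathcal A_n^{-1}\mathcal B_{n-1}^*\|\big),\qquad a_2(N)=\sup_{n\ge N}\big(\|\mathcal A_n^{-1}\mathcal B_n\|+\|\mathcal A_{n+2}^{-1}\mathcal B_{n+1}^*\|\big),$$ where $\|\cdot\|$ is the operator norm for the Euclidean norm of $\mathbb C^p$. Suppose that for some $N\in\mathbb N_0$ at least one of the following conditions holds: (i) $a_1(N)<\infty$,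 $a_2(N)<\infty$ and $a_1(N)a_2(N)<1$; (ii) $a_1(N)\le 1$ and $a_2(N)<1$, or $a_1(N)<1$ and $a_2(N)\le 1$; (iii) $\sup_{n\ge N}\big(\|\mathcal A_n^{-1}\mathcal B_n\|^s+\|\mathcal A_n^{-1}\mathcal B_{n-1}^*\|^s\big)<2^{1-s}$ for some $s\in[1,\infty)$; (iv) $\sup_{n\ge N}\big(\|\mathcal A_n^{-1}\mathcal B_n\|^s+\|\mathcal A_{n+2}^{-1}\mathcal B_{n+1}^*\|^s\big)<2^{1-s}$ for some $s\in[1,\infty)$; (v) $\sup_{n\ge N}\|\mathcal A_n^{-1}\mathcal B_n\|<\frac12$ and $\sup_{n\ge N}\|\mathcal A_n^{-1}\mathcal B_{n-1}^*\|<\frac12$. For $q\in(0,\infty]$ let $\mathcal S_q$ be the Schatten–von Neumann ideal of $l^2(\mathbb N_0;\mathbb C^p)$: the compact operators if $q=\infty$, and the bounded operators whose singular numbers are $q$-summable if $q<\infty$. (a) If $\mathcal A^{-1}\in\mathcal S_q$ for some $q\in(0,\infty]$, then $\mathbf J$ is selfadjoint, and for every $z\in\mathbb C$ with $\ker(\mathbf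 J-z)=\{0\}$ the operator $\mathbf J-z$ has a bounded everywhere defined inverse and $(\mathbf J-z)^{-1}\in\mathcal S_q$. In particular, $\mathbf J^{-1}\in\mathcal S_q$ whenever $\ker\mathbf J=\{0\}$. If one of the conditions (i), (ii), (iii), (v) holds with $N=0$, then $\mathbf J^{-1}$ exists and $\mathbf J^{-1}\in\mathcal S_q$ without any further assumption. (b) If $\mathcal A$ has discrete spectrum (i.e. its spectrum consists of isolated eigenvalues of finite multiplicity), then $\mathbf J$ is selfadjoint and has discrete spectrum. -/

import Mathlib

open scoped ENNReal

noncomputable section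

namespace BlockJacobi

/-! ### Closed operators: eigenspaces, resolvent, discrete spectrum, Schatten classes -/

section Operators

variable {H : Type*} [NormedAddCommGroup H] [InnerProductSpace ℂ H]

/-- `ker (T - z)`, as a subspace of the domain of `T`. -/
def eigenspace (T : H →ₗ.[ℂ] H) (z : ℂ) : Submodule ℂ T.domain :=
  LinearMap.ker (T.toFun - z • T.domain.subtype)

/-- The bounded everywhere defined operator `R` is the inverse of
`T - z : dom T → H`. -/
def IsInverseAt (T : H →ₗ.[ℂ] H) (z : ℂ) (R : H →L[ℂ] H) : Prop :=
  (∀ x : T.domain, R (T x - z • (x : H)) = x) ∧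
    ∀ y : H, ∃ x : T.domain, (x : H) = R y ∧ T x - z • (x : H) = y

/-- The resolvent set of `T`. -/
def opResolventSet (T : H →ₗ.[ℂ] H) : Set ℂ :=
  {z | ∃ R : H →L[ℂ] H, IsInverseAt T z R}

/-- The spectrum of `T`. -/
def opSpectrum (T : H →ₗ.[ℂ] H) : Set ℂ := (opResolventSet T)ᶜ

/-- The spectrum of `T` is discrete: it consists of isolated eigenvalues of finite
multiplicity. -/
def HasDiscreteSpectrum (T : H →ₗ.[ℂ] H) : Prop :=
  ∀ z ∈ opSpectrum T,
    (∃ ε > 0, opSpectrum T ∩ Metric.ball z ε = {z}) ∧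
      eigenspace T z ≠ ⊥ ∧ FiniteDimensional ℂ (eigenspace T z)

/-- The `n`-th singular number of `R` (starting from `n = 0`): the distance from `R` to the
operators of rank at most `n`. -/
def singularNumber (R : H →L[ℂ] H) (n : ℕ) : ℝ :=
  sInf {r : ℝ | ∃ F : H →L[ℂ] H, LinearMap.rank (F : H →ₗ[ℂ] H) ≤ (n : Cardinal) ∧ r = ‖R - F‖}

/-- The Schatten-von Neumann ideal `𝒮_q` for `q ∈ (0, ∞]`: for `q = ∞` the compact operators, for
`q < ∞` the operators whose singular numbers are `q`-summable. -/
def MemSchatten (q : ℝ≥0∞) (R : H →L[ℂ] H) : Prop :=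
  if q = ∞ then IsCompactOperator R else Summable fun n : ℕ => singularNumber R n ^ q.toReal

/-- `(T - z)⁻¹ ∈ 𝒮_q`: the operator `T - z` has a bounded everywhere defined inverse, and this
inverse belongs to `𝒮_q`. -/
def ResolventMemSchatten (q : ℝ≥0∞) (T : H →ₗ.[ℂ] H) (z : ℂ) : Prop :=
  ∃ R : H →L[ℂ] H, IsInverseAt T z R ∧ MemSchatten q R

/-- `T⁻¹ ∈ 𝒮_q`. -/
def InvMemSchatten (q : ℝ≥0∞) (T : H →ₗ.[ℂ] H) : Prop := ResolventMemSchatten q T 0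

end Operators

/-! ### Block diagonal and block Jacobi operators in `l²(ℕ₀; ℂᵖ)` -/

variable {p : ℕ}

/-- The Hilbert space `l²(ℕ₀; ℂᵖ)`. -/
abbrev L2 (p : ℕ) : Type := lp (fun _ : ℕ => EuclideanSpace ℂ (Fin p)) 2

/-- A `p × p` matrix as an operator in `ℂᵖ` with its Euclidean norm. -/
abbrev op (M : Matrix (Fin p) (Fin p) ℂ) :
    EuclideanSpace ℂ (Fin p) →L[ℂ] EuclideanSpace ℂ (Fin p) :=
  Matrix.toEuclideanCLM (n := Fin p) (𝕜 := ℂ) M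

/-- The self-adjoint operator `diag {A₀, A₁, …}` on its maximal domain
`{f ∈ l² | (Aₙ fₙ)ₙ ∈ l²}`. -/
def diagOp (A : ℕ → Matrix (Fin p) (Fin p) ℂ) : L2 p →ₗ.[ℂ] L2 p where
  domain :=
    { carrier := {f | Memℓp (fun n => op (A n) (f n)) 2}
      zero_mem' := by
        have h : (fun n => op (A n) ((0 : L2 p) n)) = 0 := by ext n; simp
        show Memℓp (fun n => op (A n) ((0 : L2 p) n)) 2
        rw [h]
        exact zero_memℓp
      add_mem' := by
        intro f g hf hg
        have h : (fun n => op (A n) ((f + g) n)) =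
            (fun n => op (A n) (f n)) + fun n => op (A n) (g n) := by
          funext n; simp only [lp.coeFn_add, Pi.add_apply, map_add]
        show Memℓp (fun n => op (A n) ((f + g) n)) 2
        rw [h]
        exact hf.add hg
      smul_mem' := by
        intro c f hf
        have h : (fun n => op (A n) ((c • f) n)) = c • fun n => op (A n) (f n) := by
          funext n; simp
        show Memℓp (fun n => op (A n) ((c • f) n)) 2
        rw [h]
        exact hf.const_smul c }
  toFun :=
    { toFun := fun f => ⟨fun n => op (A n) ((f : L2 p) n), f.2⟩
      map_add' := by intro f g; ext n : 2; exact map_add (op (A n)) _ _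
      map_smul' := by intro c f; ext n : 2; simp }

/-- `B_{n-1}`, with the convention `B_{-1} = 0`. -/
def prev (B : ℕ → Matrix (Fin p) (Fin p) ℂ) : ℕ → Matrix (Fin p) (Fin p) ℂ
  | 0 => 0
  | n + 1 => B n

/-- The `n`-th row of the formal product of the block Jacobi matrix with the sequence `f`:
`B_{n-1}* f_{n-1} + A_n f_n + B_n f_{n+1}`, the first term being absent for `n = 0`. -/
def row (A B : ℕ → Matrix (Fin p) (Fin p) ℂ) (f : ℕ → EuclideanSpace ℂ (Fin p)) (n : ℕ) :
    EuclideanSpace ℂ (Fin p) :=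
  op (prev B n).conjTranspose (f (n - 1)) + op (A n) (f n) + op (B n) (f (n + 1))

theorem row_mem (A B : ℕ → Matrix (Fin p) (Fin p) ℂ) {f : ℕ → EuclideanSpace ℂ (Fin p)}
    (hf : f.support.Finite) : Memℓp (row A B f) 2 := by
  have h0 : (row A B f).support.Finite := by
    obtain ⟨M, hM⟩ := hf.bddAbove
    refine (Set.finite_Iic (M + 1)).subset fun n hn => ?_
    by_contra hlt
    have hz : ∀ m, M < m → f m = 0 := fun m hm => by
      by_contra h
      exact absurd (hM h) (not_le.2 hm)
    have hlt' : M + 1 < n := not_le.1 hlt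
    apply hn
    simp [row, hz (n - 1) (by omega), hz n (by omega), hz (n + 1) (by omega)]
  have h1 : Memℓp (row A B f) 0 := memℓp_zero (by simpa [Function.support] using h0)
  exact h1.of_exponent_ge (by simp)

/-- The operator `J⁰` given by the block Jacobi matrix on the finite sequences. -/
def preJacobi (A B : ℕ → Matrix (Fin p) (Fin p) ℂ) : L2 p →ₗ.[ℂ] L2 p where
  domain :=
    { carrier := {f | (Function.support (f : ℕ → EuclideanSpace ℂ (Fin p))).Finite}
      zero_mem' := by
        refine Set.finite_empty.subset fun n hn => hn rfl
      add_mem' := by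
        intro f g hf hg
        exact (hf.union hg).subset (Function.support_add (f : ℕ → EuclideanSpace ℂ (Fin p)) g)
      smul_mem' := by
        intro c f hf
        exact hf.subset (Function.support_const_smul_subset c (f : ℕ → EuclideanSpace ℂ (Fin p))) }
  toFun :=
    { toFun := fun f => ⟨row A B (f : L2 p), row_mem A B f.2⟩
      map_add' := by
        intro f g; ext n : 2
        simp only [row, lp.coeFn_add, Pi.add_apply, map_add, Submodule.coe_add]; abel
      map_smul' := by
        intro c f; ext n : 2; simp [row] }

/-- The minimal block Jacobi operator `J`: the closure of `J⁰`. -/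
def jacobi (A B : ℕ → Matrix (Fin p) (Fin p) ℂ) : L2 p →ₗ.[ℂ] L2 p := (preJacobi A B).closure

theorem preJacobi_dense (A B : ℕ → Matrix (Fin p) (Fin p) ℂ) :
    Dense ((preJacobi A B).domain : Set (L2 p)) := by
  intro f
  have h := lp.hasSum_single (p := 2) (by simp) f
  refine mem_closure_of_tendsto h (Filter.Eventually.of_forall fun s => ?_)
  refine Submodule.sum_mem _ fun i _ => ?_
  refine (Set.finite_singleton i).subset fun n hn => ?_
  by_contra hne
  exact hn (by simpa using lp.single_apply_ne (E := fun _ : ℕ => EuclideanSpace ℂ (Fin p)) 2 i (f i) hne)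

theorem op_conjTranspose_inner (M : Matrix (Fin p) (Fin p) ℂ) (x y : EuclideanSpace ℂ (Fin p)) :
    inner ℂ (op M.conjTranspose x) y = inner ℂ x (op M y) := by
  have h : op M.conjTranspose = ContinuousLinearMap.adjoint (op M) := by
    rw [← Matrix.star_eq_conjTranspose, op, map_star]
    rfl
  rw [h, ContinuousLinearMap.adjoint_inner_left]

theorem green (A B : ℕ → Matrix (Fin p) (Fin p) ℂ) (hA : ∀ n, (A n).IsHermitian)
    (f g : ℕ → EuclideanSpace ℂ (Fin p)) (K : ℕ) :
    ∑ n ∈ Finset.range (K + 1), (inner ℂ (row A B f n) (g n) - inner ℂ (f n) (row A B g n)) =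
      inner ℂ (op (B K) (f (K + 1))) (g K) - inner ℂ (f K) (op (B K) (g (K + 1))) := by
  have hs : ∀ n, inner ℂ (op (A n) (f n)) (g n) = inner ℂ (f n) (op (A n) (g n)) := fun n => by
    rw [← op_conjTranspose_inner, (hA n).eq]
  have h2 : ∀ (M : Matrix (Fin p) (Fin p) ℂ) (x y : EuclideanSpace ℂ (Fin p)),
      inner ℂ x (op M.conjTranspose y) = inner ℂ (op M x) y := fun M x y => by
    rw [← op_conjTranspose_inner, Matrix.conjTranspose_conjTranspose]
  induction K with
  | zero => simp [row, prev, inner_add_left, inner_add_right, hs]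
  | succ K ih =>
    rw [Finset.sum_range_succ, ih]
    simp only [row, prev, inner_add_left, inner_add_right, hs, Nat.add_sub_cancel,
      op_conjTranspose_inner, h2]
    ring

/-- `J⁰` is closable, so that `jacobi` is its closure in the proper sense. -/
theorem preJacobi_isClosable (A B : ℕ → Matrix (Fin p) (Fin p) ℂ) (hA : ∀ n, (A n).IsHermitian) :
    (preJacobi A B).IsClosable := by
  have hfa : (preJacobi A B).IsFormalAdjoint (preJacobi A B) := by
    intro f g
    obtain ⟨M, hM⟩ := f.2.bddAbove
    obtain ⟨M', hM'⟩ := g.2.bddAbove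
    have hzf : ∀ m, M < m → (f : L2 p) m = 0 := fun m hm => by
      by_contra h
      exact absurd (hM h) (not_le.2 hm)
    have hzg : ∀ m, M' < m → (g : L2 p) m = 0 := fun m hm => by
      by_contra h
      exact absurd (hM' h) (not_le.2 hm)
    set K := M + M' + 1
    have hgr := green A B hA (f : L2 p) (g : L2 p) K
    rw [hzf (K + 1) (by omega), hzf K (by omega)] at hgr
    simp only [map_zero, inner_zero_left, sub_self, Finset.sum_sub_distrib, sub_eq_zero] at hgr
    rw [lp.inner_eq_tsum, lp.inner_eq_tsum, tsum_eq_sum (s := Finset.range (K + 1)),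
      tsum_eq_sum (s := Finset.range (K + 1))]
    · exact hgr
    · intro n hn
      rw [hzf n (by simp at hn; omega), inner_zero_left]
    · intro n hn
      rw [hzg n (by simp at hn; omega), inner_zero_right]
  exact (LinearPMap.adjoint_isClosed (preJacobi_dense A B)).isClosable.leIsClosable
    (hfa.le_adjoint (preJacobi_dense A B))

/-! ### The quantities in the conditions on the coefficients -/

/-- `‖A_n⁻¹ B_n‖` (operator norm). -/
def up (A B : ℕ → Matrix (Fin p) (Fin p) ℂ) (n : ℕ) : ℝ≥0∞ := ‖op ((A n)⁻¹ * B n)‖ₑ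

/-- `‖A_n⁻¹ B_{n-1}*‖` (operator norm), where `B_{-1} = 0`. -/
def down (A B : ℕ → Matrix (Fin p) (Fin p) ℂ) (n : ℕ) : ℝ≥0∞ :=
  ‖op ((A n)⁻¹ * (prev B n).conjTranspose)‖ₑ

/-- `a₁(N) = sup_{n ≥ N} (‖A_n⁻¹ B_n‖ + ‖A_n⁻¹ B_{n-1}*‖)`. -/
def a₁ (A B : ℕ → Matrix (Fin p) (Fin p) ℂ) (N : ℕ) : ℝ≥0∞ :=
  ⨆ n ≥ N, (up A B n + down A B n)

/-- `a₂(N) = sup_{n ≥ N} (‖A_n⁻¹ B_n‖ + ‖A_{n+2}⁻¹ B_{n+1}*‖)`. -/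
def a₂ (A B : ℕ → Matrix (Fin p) (Fin p) ℂ) (N : ℕ) : ℝ≥0∞ :=
  ⨆ n ≥ N, (up A B n + down A B (n + 2))

/-- Condition (i): `a₁(N) a₂(N) < 1`, both quantities being finite. -/
def CondI (A B : ℕ → Matrix (Fin p) (Fin p) ℂ) (N : ℕ) : Prop :=
  a₁ A B N < ∞ ∧ a₂ A B N < ∞ ∧ a₁ A B N * a₂ A B N < 1

/-- Condition (ii): `a₁(N) ≤ 1` and `a₂(N) < 1`, or `a₁(N) < 1` and `a₂(N) ≤ 1`. -/
def CondII (A B : ℕ → Matrix (Fin p) (Fin p) ℂ) (N : ℕ) : Prop :=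
  (a₁ A B N ≤ 1 ∧ a₂ A B N < 1) ∨ (a₁ A B N < 1 ∧ a₂ A B N ≤ 1)

/-- Condition (iii): for some `s ≥ 1`, `sup_{n ≥ N} (‖A_n⁻¹ B_n‖^s + ‖A_n⁻¹ B_{n-1}*‖^s) < 2^{1-s}`. -/
def CondIII (A B : ℕ → Matrix (Fin p) (Fin p) ℂ) (N : ℕ) : Prop :=
  ∃ s : ℝ, 1 ≤ s ∧ (⨆ n ≥ N, (up A B n ^ s + down A B n ^ s)) < 1 / 2 ^ (s - 1)

/-- Condition (iv): for some `s ≥ 1`, `sup_{n ≥ N} (‖A_n⁻¹ B_n‖^s + ‖A_{n+2}⁻¹ B_{n+1}*‖^s) < 2^{1-s}`. -/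
def CondIV (A B : ℕ → Matrix (Fin p) (Fin p) ℂ) (N : ℕ) : Prop :=
  ∃ s : ℝ, 1 ≤ s ∧ (⨆ n ≥ N, (up A B n ^ s + down A B (n + 2) ^ s)) < 1 / 2 ^ (s - 1)

/-- Condition (v): `sup_{n ≥ N} ‖A_n⁻¹ B_n‖ < 1/2` and `sup_{n ≥ N} ‖A_n⁻¹ B_{n-1}*‖ < 1/2`. -/
def CondV (A B : ℕ → Matrix (Fin p) (Fin p) ℂ) (N : ℕ) : Prop :=
  (⨆ n ≥ N, up A B n) < 1 / 2 ∧ (⨆ n ≥ N, down A B n) < 1 / 2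

end BlockJacobi

end

open BlockJacobi

open scoped ENNReal

noncomputable section

namespace BlockJacobi

section Operators

open Filter Topology

variable {H : Type*} [NormedAddCommGroup H] [InnerProductSpace ℂ H]

/-! ### Singular numbers and Schatten classes -/

/-! Each of the conditions (i)–(v) forces `a₁(N) < 1` or `a₂(N) < 1`. Deleting the blocks `B₀, …,
B_N` changes `J` by a bounded symmetric operator `W`, and what remains, `J - W`, is diagonally
dominant from index 0 on. If `a₁(N) < 1`, then `J - W` factors as `𝒜(1 + K)`, where the rows of the
tridiagonal `K` have norm sums at most `a₁(N)`. If `a₂(N) < 1`, it factors on finite sequences as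
`(1 + L)𝒜`; by taking adjoints of the blocks, the rows of `L` have norm sums at most `a₂(N)`. Small
row sums bound an operator in the sup norm and not in `l²`, but bandedness bridges the gap: an entry
of `K^j f` sees only `2j + 1` neighbours, so `‖K^j‖ ≤ √(2j+1) C^j → 0` and `1 + K` is invertible
(`isUnit_one_add_band`). Hence `R = (J - W)⁻¹` is `(1 + K)⁻¹𝒜⁻¹` or `𝒜⁻¹(1 + L)⁻¹`, and it lies in
every `𝒮_q` containing `𝒜⁻¹`. Surjectivity of `J - W` makes the symmetric `J` selfadjoint. Since `J
- z = (1 + (W - z)R)(J - W)` with `R` compact, the Fredholm alternative inverts `J - z` once it is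
injective, with inverse in `R · (bounded) ⊆ 𝒮_q`. For `N = 0`, `a₁(0) < 1` inverts `J` directly,
while under `a₁(0) a₂(0) < 1` a Schur test gives injectivity. For (b), discreteness forces `‖A_n⁻¹‖
→ 0`, so `𝒜⁻¹` is compact; the case `q = ∞` applies, and a symmetric operator with compact resolvent
has discrete spectrum. -/

theorem singularNumber_nonneg (R : H →L[ℂ] H) (n : ℕ) : 0 ≤ singularNumber R n :=
  Real.sInf_nonneg (by rintro _ ⟨F, -, rfl⟩; exact norm_nonneg _)

theorem singularNumber_le (R : H →L[ℂ] H) {n : ℕ} {F : H →L[ℂ] H}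
    (hF : LinearMap.rank (F : H →ₗ[ℂ] H) ≤ (n : Cardinal)) : singularNumber R n ≤ ‖R - F‖ :=
  csInf_le ⟨0, by rintro _ ⟨F, -, rfl⟩; exact norm_nonneg _⟩ ⟨F, hF, rfl⟩

theorem le_singularNumber {R : H →L[ℂ] H} {n : ℕ} {c : ℝ}
    (h : ∀ F : H →L[ℂ] H, LinearMap.rank (F : H →ₗ[ℂ] H) ≤ (n : Cardinal) → c ≤ ‖R - F‖) :
    c ≤ singularNumber R n :=
  le_csInf ⟨_, 0, by simp, rfl⟩ (by rintro _ ⟨F, hF, rfl⟩; exact h F hF)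

theorem singularNumber_le_mul {R T : H →L[ℂ] H} {n : ℕ} {c : ℝ} (hc : 0 ≤ c)
    (h : ∀ F : H →L[ℂ] H, LinearMap.rank (F : H →ₗ[ℂ] H) ≤ (n : Cardinal) →
      singularNumber T n ≤ c * ‖R - F‖) :
    singularNumber T n ≤ c * singularNumber R n := by
  rcases hc.eq_or_lt with rfl | hc
  · simpa using h 0 (by simp)
  · rw [← div_le_iff₀' hc]
    exact le_singularNumber fun F hF => by rw [div_le_iff₀' hc]; exact h F hF

theorem singularNumber_mul_le_left (S R : H →L[ℂ] H) (n : ℕ) :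
    singularNumber (S * R) n ≤ ‖S‖ * singularNumber R n := by
  refine singularNumber_le_mul (norm_nonneg S) fun F hF => ?_
  refine (singularNumber_le (F := S * F) _ ?_).trans ?_
  · exact (LinearMap.rank_comp_le_right (F : H →ₗ[ℂ] H) (S : H →ₗ[ℂ] H)).trans hF
  · rw [← mul_sub]; exact norm_mul_le _ _

theorem singularNumber_mul_le_right (R S : H →L[ℂ] H) (n : ℕ) :
    singularNumber (R * S) n ≤ ‖S‖ * singularNumber R n := by
  refine singularNumber_le_mul (norm_nonneg S) fun F hF => ?_
  refine (singularNumber_le (F := F * S) _ ?_).trans ?_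
  · exact (LinearMap.rank_comp_le_left (S : H →ₗ[ℂ] H) (F : H →ₗ[ℂ] H)).trans hF
  · rw [← sub_mul, mul_comm]; exact norm_mul_le _ _

theorem summable_singularNumber_of_le {R T : H →L[ℂ] H} {c r : ℝ} (hc : 0 ≤ c) (hr : 0 ≤ r)
    (h : ∀ n, singularNumber T n ≤ c * singularNumber R n)
    (hR : Summable fun n : ℕ => singularNumber R n ^ r) :
    Summable fun n : ℕ => singularNumber T n ^ r := by
  refine Summable.of_nonneg_of_le (fun n => Real.rpow_nonneg (singularNumber_nonneg T n) _)
    (fun n => ?_) (hR.mul_left (c ^ r))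
  rw [← Real.mul_rpow hc (singularNumber_nonneg R n)]
  exact Real.rpow_le_rpow (singularNumber_nonneg T n) (h n) hr

theorem MemSchatten.mul_left {q : ℝ≥0∞} {R : H →L[ℂ] H} (hR : MemSchatten q R) (S : H →L[ℂ] H) :
    MemSchatten q (S * R) := by
  unfold MemSchatten at *
  split_ifs at * with hq
  · exact hR.clm_comp S
  · exact summable_singularNumber_of_le (norm_nonneg S) ENNReal.toReal_nonneg
      (singularNumber_mul_le_left S R) hR

theorem MemSchatten.mul_right {q : ℝ≥0∞} {R : H →L[ℂ] H} (hR : MemSchatten q R) (S : H →L[ℂ] H) :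
    MemSchatten q (R * S) := by
  unfold MemSchatten at *
  split_ifs at * with hq
  · exact hR.comp_clm S
  · exact summable_singularNumber_of_le (norm_nonneg S) ENNReal.toReal_nonneg
      (singularNumber_mul_le_right R S) hR

theorem isCompactOperator_of_rank_le {F : H →L[ℂ] H} {n : ℕ}
    (hF : LinearMap.rank (F : H →ₗ[ℂ] H) ≤ (n : Cardinal)) : IsCompactOperator F := by
  have hfin : FiniteDimensional ℂ (LinearMap.range (F : H →ₗ[ℂ] H)) :=
    Module.rank_lt_aleph0_iff.1 (hF.trans_lt (Cardinal.natCast_lt_aleph0))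
  have : ProperSpace (LinearMap.range (F : H →ₗ[ℂ] H)) := FiniteDimensional.proper ℂ _
  exact (isCompactOperator_of_locallyCompactSpace_rng
    (LinearMap.range (F : H →ₗ[ℂ] H)).subtypeL).comp_clm
      (F.codRestrict (LinearMap.range (F : H →ₗ[ℂ] H)) fun x => ⟨x, rfl⟩)

/-- Summability with a positive exponent sends the singular numbers to zero, so `R` is a norm limit
of finite rank operators. -/
theorem MemSchatten.isCompactOperator [CompleteSpace H] {q : ℝ≥0∞} (hq : 0 < q) {R : H →L[ℂ] H}
    (hR : MemSchatten q R) : IsCompactOperator R := by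
  unfold MemSchatten at hR
  split_ifs at hR with h
  · exact hR
  have hq' : 0 < q.toReal := ENNReal.toReal_pos hq.ne' h
  have hs : Tendsto (fun n => singularNumber R n) atTop (𝓝 0) := by
    have := hR.tendsto_atTop_zero.rpow_const (p := q.toReal⁻¹) (Or.inr (by positivity))
    rw [Real.zero_rpow (by positivity)] at this
    refine this.congr fun n => ?_
    rw [← Real.rpow_mul (singularNumber_nonneg R n), mul_inv_cancel₀ hq'.ne', Real.rpow_one]
  have hex : ∀ n : ℕ, ∃ F : H →L[ℂ] H, LinearMap.rank (F : H →ₗ[ℂ] H) ≤ (n : Cardinal) ∧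
      ‖R - F‖ < singularNumber R n + 1 / ((n : ℝ) + 1) := fun n => by
    have hlt : singularNumber R n < singularNumber R n + 1 / ((n : ℝ) + 1) :=
      lt_add_of_pos_right _ Nat.one_div_pos_of_nat
    obtain ⟨_, ⟨F, hF, rfl⟩, hF'⟩ := exists_lt_of_csInf_lt
      (⟨_, 0, by simp, rfl⟩ : {r : ℝ | ∃ F : H →L[ℂ] H,
        LinearMap.rank (F : H →ₗ[ℂ] H) ≤ (n : Cardinal) ∧ r = ‖R - F‖}.Nonempty) hlt
    exact ⟨F, hF, hF'⟩
  choose F hF hF' using hex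
  refine isCompactOperator_of_tendsto (F := F) (l := atTop) ?_
    (Eventually.of_forall fun n => isCompactOperator_of_rank_le (hF n))
  rw [tendsto_iff_norm_sub_tendsto_zero]
  refine squeeze_zero (fun _ => norm_nonneg _) (fun n => ?_)
    (by simpa only [add_zero] using hs.add tendsto_one_div_add_atTop_nhds_zero_nat)
  rw [norm_sub_rev]
  exact (hF' n).le

/-! ### Perturbations by bounded operators -/

/-- Fredholm alternative for `C` at the point `-1`. -/
theorem isUnit_one_add_of_isCompactOperator [CompleteSpace H] {C : H →L[ℂ] H}
    (hC : IsCompactOperator C) (hinj : ∀ x, x + C x = 0 → x = 0) : IsUnit (1 + C) := by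
  rcases hC.hasEigenvalue_or_mem_resolventSet (μ := (-1 : ℂ)) (by simp) with h | h
  · obtain ⟨x, hx⟩ := h.exists_hasEigenvector
    refine absurd (hinj x ?_) hx.2
    have := hx.apply_eq_smul
    simp only [ContinuousLinearMap.coe_coe] at this
    rw [this]; simp
  · rw [spectrum.mem_resolventSet_iff] at h
    rw [← IsUnit.neg_iff]
    convert h using 1
    simp only [map_neg, map_one]; abel

/-- If `T - W` has the compact inverse `R` for some bounded `W`, then `T - z` has a bounded inverse
of the form `R G` as soon as it is injective. -/
theorem exists_isInverseAt_of_isCompactOperator [CompleteSpace H] {T : H →ₗ.[ℂ] H}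
    {R W : H →L[ℂ] H} (h₁ : ∀ x : T.domain, R (T x - W x) = x)
    (h₂ : ∀ y : H, ∃ x : T.domain, (x : H) = R y ∧ T x - W x = y) (hR : IsCompactOperator R)
    {z : ℂ} (hz : eigenspace T z = ⊥) : ∃ G : H →L[ℂ] H, IsInverseAt T z (R * G) := by
  -- On `dom T` one has `T - z = (1 + C)(T - W)`, because `x = R (T - W) x`. So it suffices to
  -- invert `1 + C`.
  set C : H →L[ℂ] H := (W - z • 1) * R with hCdef
  have hC : IsCompactOperator C := by
    have := hR.clm_comp (W - z • 1)
    exact this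
  have hT : ∀ x : T.domain, ∀ w, T x - W x = w → (x : H) = R w → T x - z • (x : H) = w + C w := by
    intro x w hw hx
    have : C w = W x - z • (x : H) := by simp [hCdef, hx]
    rw [this, ← hw]; abel
  have hu : IsUnit (1 + C) := by
    refine isUnit_one_add_of_isCompactOperator hC fun w hw => ?_
    obtain ⟨x, hx, hxw⟩ := h₂ w
    have hx0 : x ∈ eigenspace T z := by
      have := hT x w hxw hx
      rw [hw] at this
      simpa [eigenspace] using this
    rw [hz, Submodule.mem_bot] at hx0
    rw [← hxw, hx0]; simp
  obtain ⟨u, hu⟩ := hu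
  have hGl : ∀ w, (↑u⁻¹ : H →L[ℂ] H) (w + C w) = w := fun w => by
    have : ((↑u⁻¹ : H →L[ℂ] H) * (1 + C)) w = w := by rw [← hu, Units.inv_mul]; rfl
    simpa using this
  have hGr : ∀ w, (↑u⁻¹ : H →L[ℂ] H) w + C ((↑u⁻¹ : H →L[ℂ] H) w) = w := fun w => by
    have : ((1 + C) * (↑u⁻¹ : H →L[ℂ] H)) w = w := by rw [← hu, Units.mul_inv]; rfl
    simpa using this
  refine ⟨↑u⁻¹, fun x => ?_, fun y => ?_⟩
  · rw [hT x _ rfl (h₁ x).symm]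
    change R ((↑u⁻¹ : H →L[ℂ] H) _) = _
    rw [hGl, h₁]
  · obtain ⟨x, hx, hxw⟩ := h₂ ((↑u⁻¹ : H →L[ℂ] H) y)
    exact ⟨x, hx, by rw [hT x _ hxw hx, hGr]⟩

/-- For `x ∈ dom T*` solve `(T - W) x' = (T* - W) x`. Then `x - x'` is orthogonal to the range of `T
- W`, which is everything, so `x = x'` lies in `dom T`. -/
theorem isSelfAdjoint_of_surjective [CompleteSpace H] {T : H →ₗ.[ℂ] H}
    (hd : Dense (T.domain : Set H)) (hT : T.IsFormalAdjoint T) {W : H →L[ℂ] H}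
    (hW : ∀ x y, inner ℂ (W x) y = inner ℂ x (W y))
    (hs : ∀ y : H, ∃ x : T.domain, T x - W x = y) : IsSelfAdjoint T := by
  rw [LinearPMap.isSelfAdjoint_def]
  refine le_antisymm ?_ (hT.le_adjoint hd)
  have key : ∀ x : T.adjoint.domain, ∃ x' : T.domain, (x : H) = x' ∧ T.adjoint x = T x' := by
    intro x
    obtain ⟨x', hx'⟩ := hs (T.adjoint x - W x)
    have hxx : (x : H) = x' := by
      obtain ⟨w, hw⟩ := hs ((x : H) - x')
      have h1 : inner ℂ (T.adjoint x) (w : H) = inner ℂ (x : H) (T w) :=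
        LinearPMap.adjoint_isFormalAdjoint hd x w
      have h2 : inner ℂ (T x') (w : H) = inner ℂ (x' : H) (T w) := hT x' w
      have h3 : inner ℂ ((x : H) - x') (T w - W w) = 0 := by
        have h4 := congrArg (fun v => inner ℂ v (w : H)) hx'
        simp only [inner_sub_left, hW] at h4
        simp only [inner_sub_left, inner_sub_right, ← h1, ← h2]
        linear_combination -h4
      rw [hw, inner_self_eq_zero] at h3
      exact sub_eq_zero.1 h3
    refine ⟨x', hxx, ?_⟩
    rw [← hxx] at hx'
    simpa using hx'.symm
  refine ⟨fun x hx => ?_, fun x y hxy => ?_⟩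
  · obtain ⟨x', h, -⟩ := key ⟨x, hx⟩
    have h : x = (x' : H) := h
    rw [h]
    exact x'.2
  · obtain ⟨x', h, h'⟩ := key x
    rw [h']
    congr 1
    exact Subtype.ext (h.symm.trans hxy)

/-! ### Symmetric operators with compact resolvent -/

theorem mem_eigenspace {T : H →ₗ.[ℂ] H} {z : ℂ} {x : T.domain} :
    x ∈ eigenspace T z ↔ T x = z • (x : H) := by
  simp [eigenspace, sub_eq_zero]

theorem inner_eq_zero_of_eigenvalue_ne {T : H →ₗ.[ℂ] H} (hT : T.IsFormalAdjoint T) {z w : ℂ}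
    {x y : T.domain} (hx : T x = z • (x : H)) (hy : T y = w • (y : H))
    (hzw : starRingEnd ℂ z ≠ w) : inner ℂ (x : H) (y : H) = 0 := by
  have h := hT x y
  rw [hx, hy, inner_smul_left, inner_smul_right] at h
  by_contra hne
  exact hzw (mul_right_cancel₀ hne h)

theorem conj_eq_of_eigenvalue {T : H →ₗ.[ℂ] H} (hT : T.IsFormalAdjoint T) {z : ℂ}
    {x : T.domain} (hx : T x = z • (x : H)) (hx0 : (x : H) ≠ 0) : starRingEnd ℂ z = z := by
  by_contra h
  exact hx0 (inner_self_eq_zero.1 (inner_eq_zero_of_eigenvalue_ne hT hx hx h))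

/-- A compact operator has no orthonormal sequence of eigenvectors with eigenvalues bounded away
from zero. -/
theorem not_orthonormal_of_isCompactOperator {R : H →L[ℂ] H} (hR : IsCompactOperator R)
    {x : ℕ → H} (hx : Orthonormal ℂ x) {μ : ℕ → ℂ} {c : ℝ} (hc : 0 < c) (hμ : ∀ k, c ≤ ‖μ k‖)
    (h : ∀ k, R (x k) = μ k • x k) : False := by
  obtain ⟨K, hK, hK'⟩ := hR.image_closedBall_subset_compact (f := (R : H →ₗ[ℂ] H)) 1
  obtain ⟨y, -, φ, hφ, hy⟩ := hK.tendsto_subseq (x := fun k => R (x k)) fun k =>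
    hK' ⟨x k, by simp [hx.1 k], rfl⟩
  have hcau := hy.cauchySeq
  rw [Metric.cauchySeq_iff'] at hcau
  obtain ⟨N, hN⟩ := hcau c hc
  have hlt := hN (N + 1) (by omega)
  have hne : φ (N + 1) ≠ φ N := (hφ (Nat.lt_succ_self N)).ne'
  have horth : inner ℂ (μ (φ (N + 1)) • x (φ (N + 1))) (μ (φ N) • x (φ N)) = 0 := by
    rw [inner_smul_left, inner_smul_right, hx.2 hne]; simp
  -- By orthogonality the squared distance of two images is `|μ|² + |μ'|² ≥ 2c²`, so no subsequence
  -- of images is Cauchy.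
  have hsq := norm_sub_sq (𝕜 := ℂ) (μ (φ (N + 1)) • x (φ (N + 1))) (μ (φ N) • x (φ N))
  rw [horth] at hsq
  simp only [norm_smul, hx.1, mul_one, map_zero, mul_zero, sub_zero] at hsq
  simp only [Function.comp, h, dist_eq_norm] at hlt
  have h1 := hμ (φ (N + 1))
  nlinarith [norm_nonneg (μ (φ (N + 1)) • x (φ (N + 1)) - μ (φ N) • x (φ N)),
    sq_nonneg ‖μ (φ N)‖]

/-- The kernel of `T - z` embeds into the eigenspace of `R = (T - w)⁻¹` for the nonzero eigenvalue
`(z - w)⁻¹`. -/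
theorem finiteDimensional_eigenspace [CompleteSpace H] {T : H →ₗ.[ℂ] H} {z w : ℂ} (hzw : z ≠ w)
    {R : H →L[ℂ] H} (hR : IsInverseAt T w R) (hRc : IsCompactOperator R) :
    FiniteDimensional ℂ (eigenspace T z) := by
  have hfin := ContinuousLinearMap.finite_dimensional_eigenspace hRc (z - w)⁻¹ (inv_ne_zero (sub_ne_zero.2 hzw))
  have hmem : ∀ x : eigenspace T z,
      (((x : T.domain) : H)) ∈ Module.End.eigenspace (R : H →ₗ[ℂ] H) (z - w)⁻¹ := by
    intro x
    have h := hR.1 x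
    rw [mem_eigenspace.1 x.2, ← sub_smul, map_smul] at h
    rw [Module.End.mem_eigenspace_iff, ContinuousLinearMap.coe_coe]
    nth_rewrite 2 [← h]
    rw [inv_smul_smul₀ (sub_ne_zero.2 hzw)]
  refine FiniteDimensional.of_injective
    ((T.domain.subtype.comp (eigenspace T z).subtype).codRestrict _ hmem) fun x y hxy => ?_
  have := congrArg Subtype.val hxy
  exact Subtype.ext (Subtype.ext this)

/-- Symmetry makes the eigenvalues real, so `R = (T - i)⁻¹` exists and is compact. Infinitely many
spectral points near `z` would give `R` an orthonormal sequence of eigenvectors with eigenvalues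
bounded away from zero. -/
theorem hasDiscreteSpectrum_of_isCompactOperator [CompleteSpace H] {T : H →ₗ.[ℂ] H}
    (hT : T.IsFormalAdjoint T)
    (hres : ∀ z, eigenspace T z = ⊥ → ∃ R, IsInverseAt T z R ∧ IsCompactOperator R) :
    HasDiscreteSpectrum T := by
  have heig : ∀ z ∈ opSpectrum T, eigenspace T z ≠ ⊥ := fun z hz h => by
    obtain ⟨R, hR, -⟩ := hres z h
    exact hz ⟨R, hR⟩
  have hvec : ∀ z ∈ opSpectrum T, ∃ x : T.domain, T x = z • (x : H) ∧ ‖(x : H)‖ = 1 := by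
    intro z hz
    obtain ⟨x, hx, hx0⟩ := Submodule.exists_mem_ne_zero_of_ne_bot (heig z hz)
    rw [mem_eigenspace] at hx
    have hx0' : ‖(x : H)‖ ≠ 0 := by simpa using hx0
    refine ⟨(‖(x : H)‖⁻¹ : ℂ) • x, ?_, ?_⟩
    · rw [LinearPMap.map_smul, hx, Submodule.coe_smul, smul_comm]
    · rw [Submodule.coe_smul, norm_smul]
      simp [hx0']
  have hreal : ∀ z ∈ opSpectrum T, starRingEnd ℂ z = z := fun z hz => by
    obtain ⟨x, hx, hx1⟩ := hvec z hz
    exact conj_eq_of_eigenvalue hT hx (norm_ne_zero_iff.1 (by rw [hx1]; exact one_ne_zero))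
  have hI : eigenspace T Complex.I = ⊥ := by
    rw [Submodule.eq_bot_iff]
    intro x hx
    by_contra hx0
    have := conj_eq_of_eigenvalue hT (mem_eigenspace.1 hx) (by simpa using hx0)
    rw [Complex.conj_I] at this
    have := congrArg Complex.im this
    norm_num at this
  obtain ⟨R, hR, hRc⟩ := hres _ hI
  have hne : ∀ z ∈ opSpectrum T, z - Complex.I ≠ 0 := fun z hz h => by
    rw [sub_eq_zero.1 h] at hz
    exact heig _ hz hI
  intro z hz
  refine ⟨?_, heig z hz, finiteDimensional_eigenspace (sub_ne_zero.1 (hne z hz)) hR hRc⟩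
  have hfin : (opSpectrum T ∩ Metric.ball z 1).Finite := by
    by_contra hinf
    have hinf : (opSpectrum T ∩ Metric.ball z 1).Infinite := hinf
    set ζ := hinf.natEmbedding
    choose x hx hx1 using fun k => hvec (ζ k : ℂ) (ζ k).2.1
    refine not_orthonormal_of_isCompactOperator (x := fun k => (x k : H)) hRc ⟨hx1, ?_⟩
      -- The constant `c` comes from `|ζ - i| < 1 + |z - i|` in the unit ball around `z`.
      (μ := fun k => ((ζ k : ℂ) - Complex.I)⁻¹) (c := (1 + ‖z - Complex.I‖)⁻¹) (by positivity)
      (fun k => ?_) fun k => ?_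
    · intro k l hkl
      refine inner_eq_zero_of_eigenvalue_ne hT (hx k) (hx l) ?_
      rw [hreal _ (ζ k).2.1]
      exact fun h => hkl (ζ.injective (Subtype.ext h))
    · rw [norm_inv]
      refine inv_anti₀ (norm_pos_iff.2 (hne _ (ζ k).2.1)) ?_
      have h1 : ‖(ζ k : ℂ) - z‖ < 1 := by simpa [dist_eq_norm] using (ζ k).2.2
      have h2 : (ζ k : ℂ) - Complex.I = ((ζ k : ℂ) - z) + (z - Complex.I) := by ring
      rw [h2]
      exact (norm_add_le _ _).trans (by linarith)
    · have h := hR.1 (x k)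
      rw [hx k, ← sub_smul, map_smul] at h
      nth_rewrite 2 [← h]
      rw [inv_smul_smul₀ (hne _ (ζ k).2.1)]
  have hcl : IsClosed ((opSpectrum T ∩ Metric.ball z 1) \ {z}) := (hfin.subset Set.sdiff_subset).isClosed
  obtain ⟨ε, hε, hball⟩ := Metric.isOpen_iff.1 hcl.isOpen_compl z (by simp)
  refine ⟨min ε 1, by positivity, ?_⟩
  ext w
  constructor
  · rintro ⟨hw, hwb⟩
    by_contra hwz
    exact hball (Metric.ball_subset_ball (min_le_left _ _) hwb)
      ⟨⟨hw, Metric.ball_subset_ball (min_le_right _ _) hwb⟩, hwz⟩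
  · rintro rfl
    exact ⟨hz, Metric.mem_ball_self (by positivity)⟩

end Operators

/-! ### Block tridiagonal operators with small row sums -/

section Band

open Filter Topology

variable {p : ℕ}

theorem sum_norm_sq_le (f : L2 p) (s : Finset ℕ) : ∑ i ∈ s, ‖f i‖ ^ 2 ≤ ‖f‖ ^ 2 := by
  have := lp.sum_rpow_le_norm_rpow (p := 2) (by simp) f s
  simpa using this

theorem norm_le_of_sum_norm_sq_le {f : L2 p} {C : ℝ} (hC : 0 ≤ C)
    (h : ∀ s : Finset ℕ, ∑ i ∈ s, ‖f i‖ ^ 2 ≤ C ^ 2) : ‖f‖ ≤ C :=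
  lp.norm_le_of_forall_sum_le (p := 2) (by simp) hC fun s => by simpa using h s

theorem memℓp_of_sum_norm_sq_le {f : ℕ → EuclideanSpace ℂ (Fin p)} {C : ℝ}
    (h : ∀ s : Finset ℕ, ∑ i ∈ s, ‖f i‖ ^ 2 ≤ C) : Memℓp f 2 :=
  memℓp_gen' (C := C) fun s => by simpa using h s

/-- Square sums of a sequence dominated by local maxima of an `l²` sequence. -/
theorem sum_norm_sq_le_of_local {g : ℕ → EuclideanSpace ℂ (Fin p)} {f : L2 p} {j : ℕ} {D : ℝ}
    (h : ∀ i b, (∀ m, i ≤ m + j → m ≤ i + j → ‖f m‖ ≤ b) → ‖g i‖ ≤ D * b)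
    (s : Finset ℕ) : ∑ i ∈ s, ‖g i‖ ^ 2 ≤ D ^ 2 * ((2 * j + 1) * ‖f‖ ^ 2) := by
  have hi : ∀ i, ‖g i‖ ^ 2 ≤ D ^ 2 * ∑ m ∈ Finset.Icc (i - j) (i + j), ‖f m‖ ^ 2 := by
    intro i
    -- The local maximum is bounded by the `l²` norm over the window of radius `j`.
    have hb := h i (√(∑ m ∈ Finset.Icc (i - j) (i + j), ‖f m‖ ^ 2)) fun m h1 h2 => by
      refine Real.le_sqrt_of_sq_le ?_
      exact Finset.single_le_sum (f := fun m => ‖f m‖ ^ 2) (fun m _ => sq_nonneg _)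
        (Finset.mem_Icc.2 ⟨by omega, h2⟩)
    calc ‖g i‖ ^ 2 ≤ (D * √(∑ m ∈ Finset.Icc (i - j) (i + j), ‖f m‖ ^ 2)) ^ 2 := by gcongr
      _ = _ := by rw [mul_pow, Real.sq_sqrt (Finset.sum_nonneg fun m _ => sq_nonneg _)]
  refine (Finset.sum_le_sum fun i _ => hi i).trans ?_
  rw [← Finset.mul_sum]
  refine mul_le_mul_of_nonneg_left ?_ (sq_nonneg D)
  -- Exchange the sums: each `m` lies in the windows of at most `2j + 1` indices `i`.
  rw [Finset.sum_comm' (t' := s.biUnion fun i => Finset.Icc (i - j) (i + j))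
    (s' := fun m => s.filter fun i => m ∈ Finset.Icc (i - j) (i + j))
    (by intro i m; simp only [Finset.mem_biUnion, Finset.mem_filter]; grind)]
  calc _ ≤ ∑ m ∈ s.biUnion fun i => Finset.Icc (i - j) (i + j), (2 * j + 1 : ℝ) * ‖f m‖ ^ 2 := by
        refine Finset.sum_le_sum fun m _ => ?_
        rw [Finset.sum_const, nsmul_eq_mul]
        refine mul_le_mul_of_nonneg_right ?_ (sq_nonneg _)
        have hsub : (s.filter fun i => m ∈ Finset.Icc (i - j) (i + j)) ⊆
            Finset.Icc (m - j) (m + j) := by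
          intro i hi
          simp only [Finset.mem_filter, Finset.mem_Icc] at hi ⊢
          omega
        have hcard := Finset.card_le_card hsub
        rw [Nat.card_Icc] at hcard
        have : (s.filter fun i => m ∈ Finset.Icc (i - j) (i + j)).card ≤ 2 * j + 1 := by omega
        exact_mod_cast this
    _ ≤ _ := by
        rw [← Finset.mul_sum]
        exact mul_le_mul_of_nonneg_left (sum_norm_sq_le f _) (by positivity)

variable {P Q : ℕ → EuclideanSpace ℂ (Fin p) →L[ℂ] EuclideanSpace ℂ (Fin p)} {C : ℝ}

theorem norm_band_le (h : ∀ n, ‖P n‖ + ‖Q n‖ ≤ C) {f : ℕ → EuclideanSpace ℂ (Fin p)} {i : ℕ}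
    {b : ℝ} (h₁ : ‖f (i - 1)‖ ≤ b) (h₂ : ‖f (i + 1)‖ ≤ b) :
    ‖P i (f (i - 1)) + Q i (f (i + 1))‖ ≤ C * b := by
  have hb : 0 ≤ b := (norm_nonneg _).trans h₁
  calc _ ≤ ‖P i‖ * ‖f (i - 1)‖ + ‖Q i‖ * ‖f (i + 1)‖ :=
        norm_add_le_of_le ((P i).le_opNorm _) ((Q i).le_opNorm _)
    _ ≤ ‖P i‖ * b + ‖Q i‖ * b := by gcongr
    _ = (‖P i‖ + ‖Q i‖) * b := by ring
    _ ≤ C * b := by gcongr; exact h i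

/-- A block tridiagonal matrix with zero diagonal and bounded rows is a bounded operator. -/
theorem exists_band (h : ∀ n, ‖P n‖ + ‖Q n‖ ≤ C) :
    ∃ K : L2 p →L[ℂ] L2 p, ∀ f n, K f n = P n (f (n - 1)) + Q n (f (n + 1)) := by
  have hC : 0 ≤ C := (by positivity : 0 ≤ ‖P 0‖ + ‖Q 0‖).trans (h 0)
  have hsum : ∀ (f : L2 p) (s : Finset ℕ), ∑ i ∈ s, ‖P i (f (i - 1)) + Q i (f (i + 1))‖ ^ 2 ≤
      C ^ 2 * ((2 * (1 : ℕ) + 1) * ‖f‖ ^ 2) := fun f =>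
    sum_norm_sq_le_of_local fun i b hb =>
      norm_band_le h (hb _ (by omega) (by omega)) (hb _ (by omega) (by omega))
  let K₀ : L2 p →ₗ[ℂ] L2 p :=
    { toFun := fun f => ⟨fun n => P n (f (n - 1)) + Q n (f (n + 1)),
        memℓp_of_sum_norm_sq_le (hsum f)⟩
      map_add' := fun f g => by
        ext n : 2
        simp only [lp.coeFn_add, Pi.add_apply, map_add]; abel
      map_smul' := fun c f => by
        ext n : 2
        simp }
  refine ⟨K₀.mkContinuous (C * √3) fun f => ?_, fun f n => rfl⟩
  refine norm_le_of_sum_norm_sq_le (by positivity) fun s => (hsum f s).trans (le_of_eq ?_)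
  rw [mul_pow, mul_pow, Real.sq_sqrt (by norm_num)]
  push_cast; ring

/-- Each application of `K` costs a factor `C` in the sup norm and widens the window of relevant
entries by one on each side. -/
theorem norm_band_pow_apply_le (h : ∀ n, ‖P n‖ + ‖Q n‖ ≤ C) {K : L2 p →L[ℂ] L2 p}
    (hK : ∀ f n, K f n = P n (f (n - 1)) + Q n (f (n + 1))) (j : ℕ) (f : L2 p) (i : ℕ) (b : ℝ)
    (hb : ∀ m, i ≤ m + j → m ≤ i + j → ‖f m‖ ≤ b) : ‖(K ^ j) f i‖ ≤ C ^ j * b := by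
  induction j generalizing i with
  | zero => simpa using hb i (by omega) (by omega)
  | succ j ih =>
    have hs : (K ^ (j + 1)) f = K ((K ^ j) f) := by rw [pow_succ']; rfl
    rw [hs, hK, pow_succ', mul_assoc]
    exact norm_band_le h (ih _ fun m h1 h2 => hb m (by omega) (by omega))
      (ih _ fun m h1 h2 => hb m (by omega) (by omega))

theorem norm_band_pow_le (h : ∀ n, ‖P n‖ + ‖Q n‖ ≤ C) {K : L2 p →L[ℂ] L2 p}
    (hK : ∀ f n, K f n = P n (f (n - 1)) + Q n (f (n + 1))) (j : ℕ) :
    ‖K ^ j‖ ≤ √((2 * j + 1) * (C ^ 2) ^ j) := by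
  refine ContinuousLinearMap.opNorm_le_bound _ (Real.sqrt_nonneg _) fun f => ?_
  refine norm_le_of_sum_norm_sq_le (by positivity) fun s => ?_
  refine (sum_norm_sq_le_of_local (norm_band_pow_apply_le h hK j f) s).trans (le_of_eq ?_)
  rw [mul_pow, Real.sq_sqrt (by positivity)]
  ring

/-- If the rows of a block tridiagonal matrix `K` with zero diagonal have norm sums at most
`C < 1`, then `1 + K` is invertible in `l²`, although `K` need not be a contraction. -/
theorem isUnit_one_add_band (h : ∀ n, ‖P n‖ + ‖Q n‖ ≤ C) (hC : C < 1) {K : L2 p →L[ℂ] L2 p}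
    (hK : ∀ f n, K f n = P n (f (n - 1)) + Q n (f (n + 1))) : IsUnit (1 + K) := by
  have hC0 : 0 ≤ C := (by positivity : 0 ≤ ‖P 0‖ + ‖Q 0‖).trans (h 0)
  have hC2 : C ^ 2 < 1 := by nlinarith
  have ht : Tendsto (fun j : ℕ => (2 * (j : ℝ) + 1) * (C ^ 2) ^ j) atTop (𝓝 0) := by
    have h1 := (tendsto_self_mul_const_pow_of_lt_one (sq_nonneg C) hC2).const_mul 2
    have h2 := tendsto_pow_atTop_nhds_zero_of_lt_one (sq_nonneg C) hC2
    have h3 := h1.add h2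
    rw [mul_zero, add_zero] at h3
    exact h3.congr fun j => by ring
  obtain ⟨j, hj⟩ := (ht.eventually_lt_const one_pos).exists
  have hpow : ‖(-K) ^ j‖ < 1 := by
    have hn : ‖(-K) ^ j‖ = ‖K ^ j‖ := by
      rw [neg_pow]
      rcases neg_one_pow_eq_or (L2 p →L[ℂ] L2 p) j with h | h <;> simp [h]
    rw [hn]
    refine (norm_band_pow_le h hK j).trans_lt ?_
    rw [Real.sqrt_lt' one_pos]
    simpa using hj
  have hu := isUnit_one_sub_of_norm_lt_one hpow
  -- `1 - (-K)^j` is `1 + K` times a geometric sum commuting with it, so `1 + K` inherits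
  -- invertibility.
  rw [← mul_neg_geom_sum] at hu
  have hcomm : Commute (1 - -K) (∑ i ∈ Finset.range j, (-K) ^ i) := by
    rw [Commute, SemiconjBy, mul_neg_geom_sum, geom_sum_mul_neg]
  simpa using (hcomm.isUnit_mul_iff.1 hu).1

end Band

/-! ### Blocks, the minimal operator, and its diagonally dominant factorizations -/

section Jacobi

open Filter Topology

variable {p : ℕ} {A B : ℕ → Matrix (Fin p) (Fin p) ℂ}

theorem op_mul_apply (M M' : Matrix (Fin p) (Fin p) ℂ) (x : EuclideanSpace ℂ (Fin p)) :
    op (M * M') x = op M (op M' x) := by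
  rw [op, map_mul]; rfl

theorem op_inv_apply_op {M : Matrix (Fin p) (Fin p) ℂ} (hM : IsUnit M.det)
    (x : EuclideanSpace ℂ (Fin p)) : op M⁻¹ (op M x) = x := by
  rw [← op_mul_apply, Matrix.nonsing_inv_mul _ hM, op, map_one]; rfl

theorem op_apply_op_inv {M : Matrix (Fin p) (Fin p) ℂ} (hM : IsUnit M.det)
    (x : EuclideanSpace ℂ (Fin p)) : op M (op M⁻¹ x) = x := by
  rw [← op_mul_apply, Matrix.mul_nonsing_inv _ hM, op, map_one]; rfl

theorem norm_op_conjTranspose (M : Matrix (Fin p) (Fin p) ℂ) :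
    ‖op M.conjTranspose‖ = ‖op M‖ := by
  rw [← Matrix.star_eq_conjTranspose, op, map_star]
  exact norm_star (op M)

/-! ### The minimal operator as a closure -/

theorem preJacobi_apply (f : (preJacobi A B).domain) (n : ℕ) :
    (preJacobi A B f) n = row A B (f : L2 p) n := rfl

theorem exists_forall_ge_eq_zero (f : (preJacobi A B).domain) :
    ∃ M, ∀ m, M ≤ m → (f : L2 p) m = 0 := by
  obtain ⟨M, hM⟩ := f.2.bddAbove
  exact ⟨M + 1, fun m hm => by by_contra h; exact absurd (hM h) (by omega)⟩

theorem single_mem_domain (n : ℕ) (v : EuclideanSpace ℂ (Fin p)) :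
    (lp.single 2 n v : L2 p) ∈ (preJacobi A B).domain := by
  refine (Set.finite_singleton n).subset fun m hm => ?_
  by_contra hne
  exact hm (by simpa using lp.single_apply_ne (E := fun _ : ℕ => EuclideanSpace ℂ (Fin p)) 2 n v hne)

/-- Green's formula against an arbitrary `g ∈ l²`: the boundary term vanishes because `f` is finite.
The image of `f` may still be nonzero at index `M`, hence the range `M + 1`. -/
theorem inner_preJacobi (hA : ∀ n, (A n).IsHermitian) (f : (preJacobi A B).domain) (g : L2 p)
    {M : ℕ} (hM : ∀ m, M ≤ m → (f : L2 p) m = 0) :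
    inner ℂ (preJacobi A B f) g =
      ∑ n ∈ Finset.range (M + 1), inner ℂ ((f : L2 p) n) (row A B g n) := by
  have hgr := green A B hA (f : L2 p) g M
  rw [hM (M + 1) (by omega), hM M le_rfl] at hgr
  simp only [map_zero, inner_zero_left, sub_self, Finset.sum_sub_distrib, sub_eq_zero] at hgr
  rw [lp.inner_eq_tsum, tsum_eq_sum (s := Finset.range (M + 1))]
  · exact hgr
  · intro n hn
    have hn : M + 1 ≤ n := by simpa using hn
    rw [preJacobi_apply, row, hM (n - 1) (by omega), hM n (by omega), hM (n + 1) (by omega)]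
    simp

theorem preJacobi_isFormalAdjoint (hA : ∀ n, (A n).IsHermitian) :
    (preJacobi A B).IsFormalAdjoint (preJacobi A B) := by
  intro f g
  obtain ⟨M, hM⟩ := exists_forall_ge_eq_zero f
  rw [inner_preJacobi hA f g hM, lp.inner_eq_tsum, tsum_eq_sum (s := Finset.range (M + 1))]
  · rfl
  · intro n hn
    rw [hM n (by simp at hn; omega), inner_zero_left]

/-- Closed relations between `f` and `J⁰ f` survive passage to the closure of the graph; this is how
facts on finite sequences reach `J`. -/
theorem jacobi_mem_of_isClosed (hA : ∀ n, (A n).IsHermitian) {S : Set (L2 p × L2 p)}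
    (hS : IsClosed S) (h : ∀ f : (preJacobi A B).domain, ((f : L2 p), preJacobi A B f) ∈ S)
    (x : (jacobi A B).domain) : ((x : L2 p), jacobi A B x) ∈ S := by
  have hx : ((x : L2 p), jacobi A B x) ∈ (preJacobi A B).graph.topologicalClosure := by
    rw [(preJacobi_isClosable A B hA).graph_closure_eq_closure_graph]
    exact LinearPMap.mem_graph _ x
  refine closure_minimal (s := ((preJacobi A B).graph : Set (L2 p × L2 p))) ?_ hS hx
  rintro ⟨y, z⟩ hyz
  obtain ⟨f, hf, hf'⟩ := LinearPMap.mem_graph_iff _ |>.1 hyz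
  simp only at hf hf'
  rw [← hf, ← hf']
  exact h f

theorem isClosed_jacobi_graph (hA : ∀ n, (A n).IsHermitian) :
    IsClosed ((jacobi A B).graph : Set (L2 p × L2 p)) :=
  (preJacobi_isClosable A B hA).closure_isClosed

theorem preJacobi_mem_graph (f : (preJacobi A B).domain) :
    ((f : L2 p), preJacobi A B f) ∈ (jacobi A B).graph :=
  LinearPMap.le_graph_of_le (LinearPMap.le_closure _) (LinearPMap.mem_graph _ f)

theorem jacobi_dense : Dense ((jacobi A B).domain : Set (L2 p)) :=
  (preJacobi_dense A B).mono (LinearPMap.le_closure (preJacobi A B)).1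

theorem jacobi_isFormalAdjoint (hA : ∀ n, (A n).IsHermitian) :
    (jacobi A B).IsFormalAdjoint (jacobi A B) := by
  have h1 : ∀ (x : (jacobi A B).domain) (g : (preJacobi A B).domain),
      inner ℂ (jacobi A B x) (g : L2 p) = inner ℂ (x : L2 p) (preJacobi A B g) := fun x g =>
    jacobi_mem_of_isClosed hA (S := {w | inner ℂ w.2 (g : L2 p) = inner ℂ w.1 (preJacobi A B g)})
      (isClosed_eq (by fun_prop) (by fun_prop)) (fun f => preJacobi_isFormalAdjoint hA f g) x
  intro x y
  exact jacobi_mem_of_isClosed hA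
    (S := {w | inner ℂ (jacobi A B x) w.1 = inner ℂ (x : L2 p) w.2})
    (isClosed_eq (by fun_prop) (by fun_prop)) (fun g => h1 x g) y

theorem continuous_row (n : ℕ) : Continuous fun f : L2 p => row A B f n := by
  have h : ∀ k, Continuous fun f : L2 p => f k := fun k =>
    (lp.evalCLM ℂ (fun _ : ℕ => EuclideanSpace ℂ (Fin p)) 2 k).continuous
  have h1 := h (n - 1)
  have h2 := h n
  have h3 := h (n + 1)
  exact (((op _).continuous.comp h1).add ((op _).continuous.comp h2)).add
    ((op _).continuous.comp h3)

theorem jacobi_apply (hA : ∀ n, (A n).IsHermitian) (x : (jacobi A B).domain) (n : ℕ) :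
    (jacobi A B x) n = row A B (x : L2 p) n :=
  jacobi_mem_of_isClosed hA (S := {w | w.2 n = row A B w.1 n})
    (isClosed_eq
      ((lp.evalCLM ℂ (fun _ : ℕ => EuclideanSpace ℂ (Fin p)) 2 n).continuous.comp continuous_snd)
      ((continuous_row n).comp continuous_fst))
    (fun f => preJacobi_apply f n) x

/-- The set of `y` with `(R y, y)` in the closed graph of `J` is closed and contains the dense range
of `J⁰`, so it is the whole space. -/
theorem isInverseAt_jacobi (hA : ∀ n, (A n).IsHermitian) {R : L2 p →L[ℂ] L2 p}
    (hR : ∀ f : (preJacobi A B).domain, R (preJacobi A B f) = f)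
    (hd : Dense (Set.range (preJacobi A B))) : IsInverseAt (jacobi A B) 0 R := by
  constructor
  · intro x
    rw [zero_smul, sub_zero]
    exact jacobi_mem_of_isClosed hA (S := {w | R w.2 = w.1})
      (isClosed_eq (by fun_prop) (by fun_prop)) hR x
  · intro y
    have hcl : IsClosed {y | (R y, y) ∈ (jacobi A B).graph} :=
      (isClosed_jacobi_graph hA).preimage (f := fun y => (R y, y)) (by fun_prop)
    have hy : y ∈ {y | (R y, y) ∈ (jacobi A B).graph} := by
      refine closure_minimal ?_ hcl (hd y)
      rintro _ ⟨f, rfl⟩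
      change (R (preJacobi A B f), preJacobi A B f) ∈ (jacobi A B).graph
      rw [hR f]
      exact preJacobi_mem_graph f
    obtain ⟨x, hx, hx'⟩ := (LinearPMap.mem_graph_iff _).1 hy
    exact ⟨x, hx, by rw [zero_smul, sub_zero]; exact hx'⟩

/-- Changing the off-diagonal entries by a bounded operator `W` changes the minimal operator
by `W`. -/
theorem exists_jacobi_eq_sub {B' : ℕ → Matrix (Fin p) (Fin p) ℂ} (hA : ∀ n, (A n).IsHermitian)
    {W : L2 p →L[ℂ] L2 p} (hW : ∀ f n, W f n = row A B f n - row A B' f n)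
    (x : (jacobi A B).domain) :
    ∃ x' : (jacobi A B').domain, (x' : L2 p) = x ∧ jacobi A B' x' = jacobi A B x - W x := by
  have h : ((x : L2 p), jacobi A B x) ∈
      {w : L2 p × L2 p | (w.1, w.2 - W w.1) ∈ (jacobi A B').graph} := by
    refine jacobi_mem_of_isClosed hA ((isClosed_jacobi_graph hA).preimage
      (f := fun w : L2 p × L2 p => (w.1, w.2 - W w.1)) (by fun_prop)) (fun f => ?_) x
    have : preJacobi A B f - W f = preJacobi A B' ⟨f, f.2⟩ := by
      ext n : 2
      rw [lp.coeFn_sub, Pi.sub_apply, hW, preJacobi_apply, preJacobi_apply]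
      abel
    change ((f : L2 p), preJacobi A B f - W f) ∈ (jacobi A B').graph
    rw [this]
    exact preJacobi_mem_graph (A := A) (B := B') ⟨f, f.2⟩
  exact (LinearPMap.mem_graph_iff _).1 h

/-! ### Diagonally dominant coefficients -/

theorem row_eq_op_add {K : L2 p →L[ℂ] L2 p} (hdet : ∀ n, IsUnit (A n).det)
    (hK : ∀ f n, K f n = op ((A n)⁻¹ * (prev B n).conjTranspose) (f (n - 1)) +
      op ((A n)⁻¹ * B n) (f (n + 1))) (f : L2 p) (n : ℕ) :
    row A B f n = op (A n) ((f + K f) n) := by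
  rw [lp.coeFn_add, Pi.add_apply, hK, map_add, map_add, op_mul_apply, op_mul_apply,
    op_apply_op_inv (hdet n), op_apply_op_inv (hdet n), row]
  abel

theorem row_eq_add_of_inv {R₀ L : L2 p →L[ℂ] L2 p} (hdet : ∀ n, IsUnit (A n).det)
    (hR₀ : ∀ f n, R₀ f n = op (A n)⁻¹ (f n))
    (hL : ∀ f n, L f n = op ((prev B n).conjTranspose * (A (n - 1))⁻¹) (f (n - 1)) +
      op (B n * (A (n + 1))⁻¹) (f (n + 1))) (f : L2 p) (n : ℕ) :
    row A B (R₀ f) n = (f + L f) n := by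
  rw [lp.coeFn_add, Pi.add_apply, hL, row, hR₀, hR₀, hR₀, op_apply_op_inv (hdet n),
    op_mul_apply, op_mul_apply]
  abel

/-- A vector orthogonal to the range of `J⁰` is a formal solution of the homogeneous recurrence, as
seen by testing with sequences supported at one index. -/
theorem dense_range_preJacobi (hA : ∀ n, (A n).IsHermitian)
    (h : ∀ g : L2 p, (∀ n, row A B g n = 0) → g = 0) : Dense (Set.range (preJacobi A B)) := by
  have hbot : (LinearMap.range (preJacobi A B).toFun)ᗮ = ⊥ := by
    rw [Submodule.eq_bot_iff]
    intro g hg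
    refine h g fun n => ?_
    have h1 := hg _ ⟨⟨lp.single 2 n (row A B g n), single_mem_domain n _⟩, rfl⟩
    have h2 := inner_preJacobi (A := A) (B := B) hA
      ⟨lp.single 2 n (row A B g n), single_mem_domain n _⟩ g (M := n + 1) fun m hm => by
        simpa using lp.single_apply_ne (E := fun _ : ℕ => EuclideanSpace ℂ (Fin p)) 2 n
          (row A B g n) (show m ≠ n by omega)
    rw [Finset.sum_eq_single n] at h2
    · rw [lp.single_apply_self] at h2
      exact inner_self_eq_zero.1 (h2.symm.trans h1)
    · intro m _ hm
      rw [lp.single_apply_ne _ _ _ hm, inner_zero_left]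
    · simp
  have := (Submodule.topologicalClosure_eq_top_iff (K := LinearMap.range (preJacobi A B).toFun)).2 hbot
  have := Submodule.dense_iff_topologicalClosure_eq_top.2 this
  exact this

/-- On finite sequences `R₀ J⁰ = 1 + K`, so `(1 + K)⁻¹ R₀` is a left inverse. A formal null solution
`g` satisfies `(1 + K) g = 0`, which gives the dense range. -/
theorem exists_isInverseAt_of_rows (hA : ∀ n, (A n).IsHermitian) (hdet : ∀ n, IsUnit (A n).det)
    {R₀ : L2 p →L[ℂ] L2 p} (hR₀ : ∀ f n, R₀ f n = op (A n)⁻¹ (f n)) {C : ℝ} (hC : C < 1)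
    (h : ∀ n, ‖op ((A n)⁻¹ * (prev B n).conjTranspose)‖ + ‖op ((A n)⁻¹ * B n)‖ ≤ C) :
    ∃ G : L2 p →L[ℂ] L2 p, IsInverseAt (jacobi A B) 0 (G * R₀) := by
  obtain ⟨K, hK⟩ := exists_band h
  obtain ⟨u, hu⟩ := isUnit_one_add_band h hC hK
  have hinv : ∀ f, (↑u⁻¹ : L2 p →L[ℂ] L2 p) (f + K f) = f := fun f => by
    have : ((↑u⁻¹ : L2 p →L[ℂ] L2 p) * (1 + K)) f = f := by rw [← hu, Units.inv_mul]; rfl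
    simpa using this
  refine ⟨↑u⁻¹, isInverseAt_jacobi hA (fun f => ?_) (dense_range_preJacobi hA fun g hg => ?_)⟩
  · have : R₀ (preJacobi A B f) = f + K f := by
      ext n : 2
      rw [hR₀, preJacobi_apply, row_eq_op_add hdet hK, op_inv_apply_op (hdet n)]
    change (↑u⁻¹ : L2 p →L[ℂ] L2 p) (R₀ (preJacobi A B f)) = f
    rw [this, hinv]
  · have : g + K g = 0 := by
      ext n : 2
      rw [← op_inv_apply_op (hdet n) ((g + K g) n), ← row_eq_op_add hdet hK, hg, map_zero]
      rfl
    rw [← hinv g, this, map_zero]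

/-- On finite sequences `J⁰ R₀ = 1 + L`. The range of `J⁰` contains the image of a dense subspace
under the surjective `1 + L`. -/
theorem exists_isInverseAt_of_columns (hA : ∀ n, (A n).IsHermitian)
    (hdet : ∀ n, IsUnit (A n).det)
    {R₀ : L2 p →L[ℂ] L2 p} (hR₀ : ∀ f n, R₀ f n = op (A n)⁻¹ (f n)) {C : ℝ} (hC : C < 1)
    (h : ∀ n, ‖op ((prev B n).conjTranspose * (A (n - 1))⁻¹)‖ + ‖op (B n * (A (n + 1))⁻¹)‖ ≤ C) :
    ∃ G : L2 p →L[ℂ] L2 p, IsInverseAt (jacobi A B) 0 (R₀ * G) := by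
  obtain ⟨L, hL⟩ := exists_band h
  have hunit := isUnit_one_add_band h hC hL
  obtain ⟨u, hu⟩ := hunit
  have hinv : ∀ f, (↑u⁻¹ : L2 p →L[ℂ] L2 p) (f + L f) = f := fun f => by
    have : ((↑u⁻¹ : L2 p →L[ℂ] L2 p) * (1 + L)) f = f := by rw [← hu, Units.inv_mul]; rfl
    simpa using this
  have hsurj : Function.Surjective (1 + L : L2 p →L[ℂ] L2 p) := fun y => ⟨(↑u⁻¹ : L2 p →L[ℂ] L2 p) y, by
    have : ((1 + L) * (↑u⁻¹ : L2 p →L[ℂ] L2 p)) y = y := by rw [← hu, Units.mul_inv]; rfl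
    exact this⟩
  refine ⟨↑u⁻¹, isInverseAt_jacobi hA (fun f => ?_) ?_⟩
  -- With zero off-diagonal blocks `J⁰` is block diagonal, so `g` is the finite sequence `𝒜 f` and
  -- `f = R₀ g`.
  · let f' : (preJacobi A 0).domain := ⟨f, f.2⟩
    set g : L2 p := preJacobi A 0 f' with hg
    have hgf : R₀ g = f := by
      ext n : 2
      have hrow : row A 0 (f : L2 p) n = op (A n) ((f : L2 p) n) := by
        cases n <;> simp [row, prev]
      rw [hR₀, hg, preJacobi_apply, hrow, op_inv_apply_op (hdet n)]
    have : preJacobi A B f = g + L g := by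
      ext n : 2
      rw [← row_eq_add_of_inv hdet hR₀ hL, hgf, preJacobi_apply]
    change R₀ ((↑u⁻¹ : L2 p →L[ℂ] L2 p) (preJacobi A B f)) = f
    rw [this, hinv, hgf]
  · refine (hsurj.denseRange.dense_image (1 + L : L2 p →L[ℂ] L2 p).continuous (preJacobi_dense A B)).mono ?_
    rintro _ ⟨f, hf, rfl⟩
    have hmem : R₀ f ∈ (preJacobi A B).domain := by
      refine hf.subset fun n hn => ?_
      by_contra hfn
      have hfn : f n = 0 := by simpa using hfn
      exact hn (by rw [hR₀, hfn, map_zero])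
    refine ⟨⟨R₀ f, hmem⟩, ?_⟩
    ext n : 2
    rw [preJacobi_apply, row_eq_add_of_inv hdet hR₀ hL]
    rfl

end Jacobi

section Conditions

open Filter Topology

variable {p : ℕ} {A B : ℕ → Matrix (Fin p) (Fin p) ℂ} {N : ℕ}

/-! ### Consequences of the conditions on the coefficients -/

theorem CondI.a₁_lt_one_or_a₂_lt_one (h : CondI A B N) : a₁ A B N < 1 ∨ a₂ A B N < 1 := by
  by_contra! hc
  refine absurd h.2.2 (not_lt.2 ?_)
  simpa using mul_le_mul' hc.1 hc.2

theorem CondII.condI (h : CondII A B N) : CondI A B N := by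
  rcases h with ⟨h1, h2⟩ | ⟨h1, h2⟩
  · refine ⟨h1.trans_lt ENNReal.one_lt_top, h2.trans ENNReal.one_lt_top, ?_⟩
    calc _ ≤ 1 * a₂ A B N := mul_le_mul_left h1 _
      _ < 1 := by simpa using h2
  · refine ⟨h1.trans ENNReal.one_lt_top, h2.trans_lt ENNReal.one_lt_top, ?_⟩
    calc _ ≤ a₁ A B N * 1 := mul_le_mul_right h2 _
      _ < 1 := by simpa using h1

/-- Convexity: `(x + y)^s ≤ 2^(s-1) (x^s + y^s)`. -/
theorem iSup_add_lt_one_of_iSup_rpow {x y : ℕ → ℝ≥0∞} {s : ℝ} (hs : 1 ≤ s)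
    (h : (⨆ n ≥ N, (x n ^ s + y n ^ s)) < 1 / 2 ^ (s - 1)) : (⨆ n ≥ N, (x n + y n)) < 1 := by
  have hs0 : 0 < s := by linarith
  have h2 : (2 : ℝ≥0∞) ^ (s - 1) ≠ 0 := by simp
  have h2' : (2 : ℝ≥0∞) ^ (s - 1) ≠ ∞ := ENNReal.rpow_ne_top_of_nonneg (by linarith) (by simp)
  rw [ENNReal.lt_div_iff_mul_lt (Or.inl h2) (Or.inl h2'), mul_comm] at h
  refine lt_of_le_of_lt (iSup₂_le fun n hn => ?_) (ENNReal.rpow_lt_one h (inv_pos.2 hs0))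
  rw [ENNReal.le_rpow_inv_iff hs0]
  refine (ENNReal.rpow_add_le_mul_rpow_add_rpow _ _ hs).trans ?_
  gcongr
  exact le_iSup₂ (f := fun n (_ : n ≥ N) => x n ^ s + y n ^ s) n hn

theorem CondIII.a₁_lt_one (h : CondIII A B N) : a₁ A B N < 1 :=
  let ⟨_, hs, h⟩ := h; iSup_add_lt_one_of_iSup_rpow hs h

theorem CondIV.a₂_lt_one (h : CondIV A B N) : a₂ A B N < 1 :=
  let ⟨_, hs, h⟩ := h
  iSup_add_lt_one_of_iSup_rpow (y := fun n => down A B (n + 2)) hs h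

theorem CondV.a₁_lt_one (h : CondV A B N) : a₁ A B N < 1 := by
  have hlt := ENNReal.add_lt_add h.1 h.2
  rw [ENNReal.add_halves] at hlt
  refine lt_of_le_of_lt (iSup₂_le fun n hn => ?_) hlt
  exact add_le_add (le_iSup₂ (f := fun n (_ : n ≥ N) => up A B n) n hn)
    (le_iSup₂ (f := fun n (_ : n ≥ N) => down A B n) n hn)

theorem norm_add_norm_le_toReal {E F : Type*} [SeminormedAddCommGroup E]
    [SeminormedAddCommGroup F] {x : E} {y : F} {a : ℝ≥0∞} (ha : a ≠ ∞) (h : ‖x‖ₑ + ‖y‖ₑ ≤ a) :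
    ‖x‖ + ‖y‖ ≤ a.toReal := by
  have := ENNReal.toReal_mono ha h
  rwa [ENNReal.toReal_add (by simp) (by simp), toReal_enorm, toReal_enorm] at this

theorem norm_rows_le_toReal_a₁ (ha : a₁ A B N ≠ ∞) {n : ℕ} (hn : N ≤ n) :
    ‖op ((A n)⁻¹ * B n)‖ + ‖op ((A n)⁻¹ * (prev B n).conjTranspose)‖ ≤ (a₁ A B N).toReal :=
  norm_add_norm_le_toReal ha (le_iSup₂ (f := fun n (_ : n ≥ N) => up A B n + down A B n) n hn)

theorem norm_columns_le_toReal_a₂ (ha : a₂ A B N ≠ ∞) {n : ℕ} (hn : N ≤ n) :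
    ‖op ((A n)⁻¹ * B n)‖ + ‖op ((A (n + 2))⁻¹ * (B (n + 1)).conjTranspose)‖ ≤
      (a₂ A B N).toReal :=
  norm_add_norm_le_toReal ha
    (le_iSup₂ (f := fun n (_ : n ≥ N) => up A B n + down A B (n + 2)) n hn)

/-- Passing to adjoints turns the entries of `L` into the quantities occurring in `a₂`. -/
theorem norm_op_mul_inv {M M' : Matrix (Fin p) (Fin p) ℂ} (hM : M.IsHermitian) :
    ‖op (M' * M⁻¹)‖ = ‖op (M⁻¹ * M'.conjTranspose)‖ := by
  rw [← norm_op_conjTranspose, Matrix.conjTranspose_mul, Matrix.conjTranspose_nonsing_inv, hM.eq]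

/-! ### Removing finitely many off-diagonal blocks -/

/-- The sequence `B` with the blocks `B₀, …, B_N` replaced by zero. -/
def cutoff (N : ℕ) (B : ℕ → Matrix (Fin p) (Fin p) ℂ) (n : ℕ) : Matrix (Fin p) (Fin p) ℂ :=
  if n ≤ N then 0 else B n

theorem norm_op_zero : ‖op (0 : Matrix (Fin p) (Fin p) ℂ)‖ = 0 := by
  rw [op, map_zero, norm_zero]

theorem prev_cutoff_eq (n : ℕ) : prev (cutoff N B) n = if n ≤ N + 1 then 0 else prev B n := by
  cases n <;> simp [prev, cutoff]

/-- After the cutoff only rows `n > N` survive. Row `n` of `L` is controlled by the term of `a₂` at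
`n - 1 ≥ N`, which is why `B_N` is removed too. -/
theorem exists_isInverseAt_cutoff (hA : ∀ n, (A n).IsHermitian) (hdet : ∀ n, IsUnit (A n).det)
    {R₀ : L2 p →L[ℂ] L2 p} (hR₀ : ∀ f n, R₀ f n = op (A n)⁻¹ (f n))
    (h : a₁ A B N < 1 ∨ a₂ A B N < 1) :
    ∃ R : L2 p →L[ℂ] L2 p, IsInverseAt (jacobi A (cutoff N B)) 0 R ∧
      ∀ q, MemSchatten q R₀ → MemSchatten q R := by
  rcases h with h | h
  · have htop : a₁ A B N ≠ ∞ := (h.trans ENNReal.one_lt_top).ne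
    have hC : (a₁ A B N).toReal < 1 := by
      simpa using ENNReal.toReal_strict_mono ENNReal.one_ne_top h
    obtain ⟨G, hG⟩ := exists_isInverseAt_of_rows (B := cutoff N B) hA hdet hR₀ hC fun n => by
      rw [prev_cutoff_eq, cutoff]
      by_cases h1 : n ≤ N
      · simp only [h1, le_add_right h1, if_true, Matrix.conjTranspose_zero, mul_zero,
          norm_op_zero, add_zero]
        exact ENNReal.toReal_nonneg
      · have hle := norm_rows_le_toReal_a₁ htop (show N ≤ n by omega)
        rw [add_comm, if_neg h1]
        refine le_trans (add_le_add_right ?_ _) hle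
        split_ifs
        · rw [Matrix.conjTranspose_zero, mul_zero, norm_op_zero]; exact norm_nonneg _
        · exact le_rfl
    exact ⟨_, hG, fun q hq => hq.mul_left G⟩
  · have htop : a₂ A B N ≠ ∞ := (h.trans ENNReal.one_lt_top).ne
    have hC : (a₂ A B N).toReal < 1 := by
      simpa using ENNReal.toReal_strict_mono ENNReal.one_ne_top h
    obtain ⟨G, hG⟩ := exists_isInverseAt_of_columns (B := cutoff N B) hA hdet hR₀ hC fun n => by
      rw [prev_cutoff_eq, cutoff]
      by_cases h1 : n ≤ N
      · simp only [h1, le_add_right h1, if_true, Matrix.conjTranspose_zero, zero_mul,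
          norm_op_zero, add_zero]
        exact ENNReal.toReal_nonneg
      · obtain ⟨m, rfl⟩ : ∃ m, n = m + 1 := ⟨n - 1, by omega⟩
        have hle := norm_columns_le_toReal_a₂ htop (show N ≤ m by omega)
        rw [if_neg h1, norm_op_mul_inv (hA _), norm_op_mul_inv (hA _)]
        refine le_trans (add_le_add_left ?_ _) hle
        split_ifs
        · simp only [Matrix.conjTranspose_zero, mul_zero, norm_op_zero]; exact norm_nonneg _
        · rw [Matrix.conjTranspose_conjTranspose]; exact le_rfl
    exact ⟨_, hG, fun q hq => hq.mul_right G⟩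

theorem exists_row_sub_row_cutoff (N : ℕ) (A B : ℕ → Matrix (Fin p) (Fin p) ℂ) :
    ∃ W : L2 p →L[ℂ] L2 p, ∀ f n, W f n = row A B f n - row A (cutoff N B) f n := by
  set D : ℕ → Matrix (Fin p) (Fin p) ℂ := fun n => if n ≤ N then B n else 0 with hD
  have hprev : ∀ n, prev D n = if n ≤ N + 1 then prev B n else 0 := fun n => by
    cases n <;> simp [prev, D]
  obtain ⟨W, hW⟩ := exists_band (P := fun n => op (prev D n).conjTranspose) (Q := fun n => op (D n))
    (C := ∑ n ∈ Finset.range (N + 2), (‖op (prev D n).conjTranspose‖ + ‖op (D n)‖)) fun n => by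
      by_cases hn : n < N + 2
      · exact Finset.single_le_sum
          (f := fun n => ‖op (prev D n).conjTranspose‖ + ‖op (D n)‖)
          (fun _ _ => by positivity) (Finset.mem_range.2 hn)
      · have h1 : D n = 0 := if_neg (by omega)
        have h2 : prev D n = 0 := by rw [hprev, if_neg (by omega)]
        rw [h1, h2, Matrix.conjTranspose_zero, norm_op_zero, add_zero]
        exact Finset.sum_nonneg fun _ _ => by positivity
  refine ⟨W, fun f n => ?_⟩
  rw [hW, row, row, hprev, prev_cutoff_eq]
  simp only [D, cutoff]
  split_ifs <;> simp
  abel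

theorem inner_eq_of_row_sub_row {B' : ℕ → Matrix (Fin p) (Fin p) ℂ}
    (hA : ∀ n, (A n).IsHermitian) {W : L2 p →L[ℂ] L2 p}
    (hW : ∀ f n, W f n = row A B f n - row A B' f n) (x y : L2 p) :
    inner ℂ (W x) y = inner ℂ x (W y) := by
  have hpre : ∀ f : (preJacobi A B).domain,
      W f = preJacobi A B f - preJacobi A B' ⟨f, f.2⟩ := fun f => by
    ext n : 2
    rw [hW]; rfl
  have hfin : ∀ f g : (preJacobi A B).domain, inner ℂ (W f) (g : L2 p) = inner ℂ (f : L2 p) (W g) :=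
    fun f g => by
      rw [hpre, hpre, inner_sub_left, inner_sub_right, preJacobi_isFormalAdjoint hA f g]
      congr 1
      exact preJacobi_isFormalAdjoint (B := B') hA ⟨f, f.2⟩ ⟨g, g.2⟩
  have hd := preJacobi_dense A B
  have h1 : ∀ f : (preJacobi A B).domain, ∀ y, inner ℂ (W f) y = inner ℂ (f : L2 p) (W y) :=
    fun f => congrFun (Continuous.ext_on hd (by fun_prop) (by fun_prop) fun g hg => hfin f ⟨g, hg⟩)
  exact congrFun (Continuous.ext_on (f := fun x => inner ℂ (W x) y)
    (g := fun x => inner ℂ x (W y)) hd (by fun_prop) (by fun_prop) fun f hf => h1 ⟨f, hf⟩ y) x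

/-- `J` is a bounded symmetric perturbation of an operator whose inverse belongs to all the
Schatten classes of `diag {Aₙ}⁻¹`. -/
theorem exists_isInverseAt_jacobi_sub (hA : ∀ n, (A n).IsHermitian)
    (hdet : ∀ n, IsUnit (A n).det)
    {R₀ : L2 p →L[ℂ] L2 p} (hR₀ : ∀ f n, R₀ f n = op (A n)⁻¹ (f n))
    (h : a₁ A B N < 1 ∨ a₂ A B N < 1) :
    ∃ R W : L2 p →L[ℂ] L2 p, (∀ x y, inner ℂ (W x) y = inner ℂ x (W y)) ∧
      (∀ x : (jacobi A B).domain, R (jacobi A B x - W x) = x) ∧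
      (∀ y : L2 p, ∃ x : (jacobi A B).domain, (x : L2 p) = R y ∧ jacobi A B x - W x = y) ∧
      ∀ q, MemSchatten q R₀ → MemSchatten q R := by
  obtain ⟨R, hR, hRq⟩ := exists_isInverseAt_cutoff hA hdet hR₀ h
  obtain ⟨W, hW⟩ := exists_row_sub_row_cutoff N A B
  refine ⟨R, W, inner_eq_of_row_sub_row hA hW, fun x => ?_, fun y => ?_, hRq⟩
  · obtain ⟨x', hx', h'⟩ := exists_jacobi_eq_sub hA hW x
    have := hR.1 x'
    rwa [zero_smul, sub_zero, h', hx'] at this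
  · obtain ⟨x', hx', h'⟩ := hR.2 y
    -- The reverse inclusion of domains: add `W` back by exchanging the two coefficient sequences.
    obtain ⟨x, hx, h⟩ := exists_jacobi_eq_sub (A := A) (B := cutoff N B) (B' := B) hA (W := -W)
      (fun f n => by
        rw [neg_apply, lp.coeFn_neg, Pi.neg_apply, hW, neg_sub]) x'
    refine ⟨x, hx.trans hx', ?_⟩
    rw [zero_smul, sub_zero] at h'
    rw [h, h', hx]
    simp

/-! ### Injectivity under the first condition -/

/-- Weighted Cauchy–Schwarz; the defect is `ab(x - y)²`. -/
theorem sq_add_mul_le {a b s x y : ℝ} (ha : 0 ≤ a) (hb : 0 ≤ b) (h : a + b ≤ s) :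
    (a * x + b * y) ^ 2 ≤ s * (a * x ^ 2 + b * y ^ 2) := by
  have h1 : 0 ≤ (s - (a + b)) * (a * x ^ 2 + b * y ^ 2) :=
    mul_nonneg (by linarith) (by positivity)
  have h2 : 0 ≤ a * b * (x - y) ^ 2 := by positivity
  nlinarith

/-- A square summable nonnegative sequence which is dominated by its image under a Jacobi matrix
satisfying the Schur test vanishes. -/
theorem eq_zero_of_le_schur {x u d : ℕ → ℝ} {a b M : ℝ} (hx : ∀ n, 0 ≤ x n) (hu : ∀ n, 0 ≤ u n)
    (hd : ∀ n, 0 ≤ d n) (ha : ∀ n, u n + d n ≤ a) (hb : ∀ n, u n + d (n + 2) ≤ b)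
    (hab : a * b < 1) (h0 : x 0 ≤ u 0 * x 1)
    (h : ∀ n, x (n + 1) ≤ u (n + 1) * x (n + 2) + d (n + 1) * x n)
    (hM : ∀ K, ∑ n ∈ Finset.range K, x n ^ 2 ≤ M) (n : ℕ) : x n = 0 := by
  have ha0 : 0 ≤ a := (add_nonneg (hu 0) (hd 0)).trans (ha 0)
  have hb0 : 0 ≤ b := (add_nonneg (hu 0) (hd 2)).trans (hb 0)
  have hud : d 1 * u 0 ≤ 1 := by
    have h1 : d 1 ≤ a := by linarith [ha 1, hu 1]
    have h2 : u 0 ≤ b := by linarith [hb 0, hd 2]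
    nlinarith [mul_le_mul h1 h2 (hu 0) ha0]
  -- Column 0 contributes `d 1`, which `b` does not control. This term is absorbed by `u 0 * x 1 ^
  -- 2`, which is free because the sums `S` start at `x 1`.
  have h01 : d 1 * x 0 ^ 2 ≤ u 0 * x 1 ^ 2 := by
    have h1 : x 0 ^ 2 ≤ (u 0 * x 1) ^ 2 := pow_le_pow_left₀ (hx 0) h0 2
    calc d 1 * x 0 ^ 2 ≤ d 1 * (u 0 * x 1) ^ 2 := mul_le_mul_of_nonneg_left h1 (hd 1)
      _ = (d 1 * u 0) * (u 0 * x 1 ^ 2) := by ring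
      _ ≤ 1 * (u 0 * x 1 ^ 2) :=
        mul_le_mul_of_nonneg_right hud (mul_nonneg (hu 0) (sq_nonneg _))
      _ = u 0 * x 1 ^ 2 := one_mul _
  set S : ℕ → ℝ := fun K => ∑ n ∈ Finset.range K, x (n + 1) ^ 2 with hS
  have hstep : ∀ K, S K ≤ a * b * S (K + 1) := by
    intro K
    have h1 : S K ≤ a * (∑ n ∈ Finset.range K, u (n + 1) * x (n + 2) ^ 2 +
        ∑ n ∈ Finset.range K, d (n + 1) * x n ^ 2) := by
      rw [← Finset.sum_add_distrib, Finset.mul_sum]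
      refine Finset.sum_le_sum fun n _ => ?_
      exact (pow_le_pow_left₀ (hx _) (h n) 2).trans (sq_add_mul_le (hu _) (hd _) (ha _))
    have h2 : ∑ n ∈ Finset.range (K + 1), u n * x (n + 1) ^ 2 =
        ∑ n ∈ Finset.range K, u (n + 1) * x (n + 2) ^ 2 + u 0 * x 1 ^ 2 :=
      Finset.sum_range_succ' (fun n => u n * x (n + 1) ^ 2) K
    have h3 : ∑ n ∈ Finset.range (K + 2), d (n + 1) * x n ^ 2 =
        ∑ n ∈ Finset.range (K + 1), d (n + 2) * x (n + 1) ^ 2 + d 1 * x 0 ^ 2 :=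
      Finset.sum_range_succ' (fun n => d (n + 1) * x n ^ 2) (K + 1)
    have h4 : ∑ n ∈ Finset.range K, d (n + 1) * x n ^ 2 ≤
        ∑ n ∈ Finset.range (K + 2), d (n + 1) * x n ^ 2 :=
      Finset.sum_le_sum_of_subset_of_nonneg (Finset.range_subset_range.2 (by omega))
        fun n _ _ => mul_nonneg (hd _) (sq_nonneg _)
    have h5 : ∑ n ∈ Finset.range (K + 1), u n * x (n + 1) ^ 2 +
        ∑ n ∈ Finset.range (K + 1), d (n + 2) * x (n + 1) ^ 2 ≤ b * S (K + 1) := by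
      rw [← Finset.sum_add_distrib, hS, Finset.mul_sum]
      refine Finset.sum_le_sum fun n _ => ?_
      rw [← add_mul]
      exact mul_le_mul_of_nonneg_right (hb n) (sq_nonneg _)
    calc S K ≤ _ := h1
      _ ≤ a * (b * S (K + 1)) := mul_le_mul_of_nonneg_left (by linarith) ha0
      _ = _ := by ring
  have hSM : ∀ K, S K ≤ M := fun K => by
    have := hM (K + 1)
    rw [Finset.sum_range_succ'] at this
    linarith [sq_nonneg (x 0)]
  have hmono : Monotone S := monotone_nat_of_le_succ fun K => by
    simp only [hS, Finset.sum_range_succ]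
    linarith [sq_nonneg (x (K + 1))]
  have hbdd : BddAbove (Set.range S) := ⟨M, by rintro _ ⟨K, rfl⟩; exact hSM K⟩
  have hS0 : 0 ≤ ⨆ K, S K := le_ciSup_of_le hbdd 0 (by simp [hS])
  -- Square summability makes the supremum finite, and `ab < 1` then forces it to vanish.
  have hsup : ⨆ K, S K ≤ a * b * ⨆ K, S K :=
    ciSup_le fun K => (hstep K).trans
      (mul_le_mul_of_nonneg_left (le_ciSup hbdd (K + 1)) (mul_nonneg ha0 hb0))
  have hsup0 : ⨆ K, S K ≤ 0 := by nlinarith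
  have hpos : ∀ n, x (n + 1) = 0 := fun n => by
    have h1 : S (n + 1) ≤ 0 := (le_ciSup hbdd (n + 1)).trans hsup0
    have h2 : x (n + 1) ^ 2 ≤ S (n + 1) :=
      Finset.single_le_sum (f := fun n => x (n + 1) ^ 2) (fun _ _ => sq_nonneg _)
        (Finset.mem_range.2 (Nat.lt_succ_self n))
    exact pow_eq_zero_iff two_ne_zero |>.1 (le_antisymm (h2.trans h1) (sq_nonneg _))
  cases n with
  | zero => exact le_antisymm (by simpa [hpos 0] using h0) (hx 0)
  | succ n => exact hpos n

theorem CondI.eq_zero_of_row_eq_zero (h : CondI A B 0) (hdet : ∀ n, IsUnit (A n).det) {g : L2 p}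
    (hg : ∀ n, row A B g n = 0) : g = 0 := by
  obtain ⟨h1, h2, h3⟩ := h
  have hgn : ∀ n, g n = -(op ((A n)⁻¹ * B n) (g (n + 1)) +
      op ((A n)⁻¹ * (prev B n).conjTranspose) (g (n - 1))) := fun n => by
    have := congrArg (op (A n)⁻¹) (hg n)
    rw [row, map_add, map_add, op_inv_apply_op (hdet n), map_zero, ← op_mul_apply,
      ← op_mul_apply] at this
    rw [eq_neg_iff_add_eq_zero, ← this]
    abel
  have hle : ∀ n, ‖g n‖ ≤ ‖op ((A n)⁻¹ * B n)‖ * ‖g (n + 1)‖ +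
      ‖op ((A n)⁻¹ * (prev B n).conjTranspose)‖ * ‖g (n - 1)‖ := fun n => by
    rw [hgn n, norm_neg]
    exact norm_add_le_of_le (ContinuousLinearMap.le_opNorm _ _) (ContinuousLinearMap.le_opNorm _ _)
  have hzero := eq_zero_of_le_schur (x := fun n => ‖g n‖) (u := fun n => ‖op ((A n)⁻¹ * B n)‖)
    (d := fun n => ‖op ((A n)⁻¹ * (prev B n).conjTranspose)‖) (a := (a₁ A B 0).toReal)
    (b := (a₂ A B 0).toReal) (M := ‖g‖ ^ 2) (fun _ => norm_nonneg _) (fun _ => norm_nonneg _)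
    (fun _ => norm_nonneg _) (fun n => norm_rows_le_toReal_a₁ h1.ne (Nat.zero_le n))
    (fun n => norm_columns_le_toReal_a₂ h2.ne (Nat.zero_le n))
    (by
      rw [← ENNReal.toReal_mul]
      simpa using ENNReal.toReal_strict_mono ENNReal.one_ne_top h3)
    (by
      have h := hle 0
      simp only [prev, Matrix.conjTranspose_zero, mul_zero, norm_op_zero, zero_mul, add_zero] at h
      exact h)
    (fun n => hle (n + 1)) (fun K => sum_norm_sq_le g _)
  ext n : 2
  exact norm_eq_zero.1 (hzero n)

end Conditions

section Diagonal

open Filter Topology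

variable {p : ℕ} {A : ℕ → Matrix (Fin p) (Fin p) ℂ}

/-! ### The block diagonal operator -/

theorem ker_eq_eigenspace_zero {H : Type*} [NormedAddCommGroup H] [InnerProductSpace ℂ H]
    (T : H →ₗ.[ℂ] H) : LinearMap.ker T.toFun = eigenspace T 0 := by
  rw [eigenspace, zero_smul, sub_zero]

theorem single_mem_diagOp_domain (n : ℕ) (v : EuclideanSpace ℂ (Fin p)) :
    (lp.single 2 n v : L2 p) ∈ (diagOp A).domain := by
  have h : (fun m => op (A m) ((lp.single 2 n v : L2 p) m)) =
      (lp.single 2 n (op (A n) v) : L2 p) := by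
    funext m
    by_cases hm : m = n
    · subst hm
      rw [lp.single_apply_self, lp.single_apply_self]
    · rw [lp.single_apply_ne _ _ _ hm, lp.single_apply_ne _ _ _ hm, map_zero]
  change Memℓp (fun m => op (A m) ((lp.single 2 n v : L2 p) m)) 2
  rw [h]
  exact lp.memℓp _

theorem diagOp_single (n : ℕ) (v : EuclideanSpace ℂ (Fin p)) :
    diagOp A ⟨lp.single 2 n v, single_mem_diagOp_domain n v⟩ = lp.single 2 n (op (A n) v) := by
  ext m : 2
  change op (A m) ((lp.single 2 n v : L2 p) m) = _
  by_cases hm : m = n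
  · subst hm
    rw [lp.single_apply_self, lp.single_apply_self]
  · rw [lp.single_apply_ne _ _ _ hm, lp.single_apply_ne _ _ _ hm, map_zero]

theorem isUnit_det_of_ker_diagOp (hker : LinearMap.ker (diagOp A).toFun = ⊥) (n : ℕ) :
    IsUnit (A n).det := by
  rw [isUnit_iff_ne_zero]
  intro h
  obtain ⟨v, hv, hAv⟩ := Matrix.exists_mulVec_eq_zero_iff.2 h
  have hop : op (A n) (WithLp.toLp 2 v) = 0 := by
    rw [op, Matrix.toEuclideanCLM_toLp, hAv]; rfl
  have hmem : (⟨lp.single 2 n (WithLp.toLp 2 v), single_mem_diagOp_domain n _⟩ :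
      (diagOp A).domain) ∈ LinearMap.ker (diagOp A).toFun := by
    rw [LinearMap.mem_ker]
    have := diagOp_single (A := A) n (WithLp.toLp 2 v)
    rw [hop, lp.single_zero] at this
    exact this
  rw [hker, Submodule.mem_bot] at hmem
  have h1 : (lp.single 2 n (WithLp.toLp 2 v) : L2 p) = 0 := congrArg Subtype.val hmem
  have h2 := congrArg (fun f : L2 p => f n) h1
  simp only [lp.single_apply_self] at h2
  exact hv (congrArg WithLp.ofLp h2)

theorem inverse_diagOp_apply (hdet : ∀ n, IsUnit (A n).det) {R : L2 p →L[ℂ] L2 p}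
    (hR : IsInverseAt (diagOp A) 0 R) (f : L2 p) (n : ℕ) : R f n = op (A n)⁻¹ (f n) := by
  obtain ⟨x, hx, hxf⟩ := hR.2 f
  rw [zero_smul, sub_zero] at hxf
  rw [← hx, ← hxf]
  exact (op_inv_apply_op (hdet n) _).symm

/-- The norm of the selfadjoint `M⁻¹` is its spectral radius, so some eigenvalue has modulus at
least `ε`; its reciprocal is an eigenvalue of `M`. -/
theorem exists_eigenvector_of_le_norm_op_inv {M : Matrix (Fin p) (Fin p) ℂ} (hM : M.IsHermitian)
    (hdet : IsUnit M.det) {ε : ℝ} (hε : 0 < ε) (h : ε ≤ ‖op M⁻¹‖) :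
    ∃ (v : EuclideanSpace ℂ (Fin p)) (z : ℂ), ‖v‖ = 1 ∧ op M v = z • v ∧ ‖z‖ ≤ ε⁻¹ := by
  have hne : op M⁻¹ ≠ 0 := fun h0 => by rw [h0, norm_zero] at h; linarith
  have : Nontrivial (EuclideanSpace ℂ (Fin p) →L[ℂ] EuclideanSpace ℂ (Fin p)) := ⟨_, _, hne⟩
  have hsa : IsSelfAdjoint (op M⁻¹) := by
    rw [IsSelfAdjoint, op, ← map_star, Matrix.star_eq_conjTranspose, hM.inv.eq]
  obtain ⟨μ, hμ, hμn⟩ := spectrum.exists_nnnorm_eq_spectralRadius (op M⁻¹)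
  have hμn : ‖μ‖ = ‖op M⁻¹‖ := congrArg NNReal.toReal
    (ENNReal.coe_injective (hμn.trans (ContinuousLinearMap.spectralRadius_eq_nnnorm _ hsa)))
  have hμε : ε ≤ ‖μ‖ := by rwa [hμn]
  have hμ0 : μ ≠ 0 := norm_pos_iff.1 (hε.trans_le hμε)
  have hc : IsCompactOperator (op M⁻¹) := isCompactOperator_of_locallyCompactSpace_dom _
  obtain ⟨v, hv⟩ := ((hc.hasEigenvalue_iff_mem_spectrum hμ0).2 hμ).exists_hasEigenvector
  have hv1 : op M⁻¹ v = μ • v := hv.apply_eq_smul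
  have hv2 : op M v = μ⁻¹ • v := by
    have := op_apply_op_inv hdet v
    rw [hv1, map_smul] at this
    rw [← this, inv_smul_smul₀ hμ0, this]
  have hv0 : ‖v‖ ≠ 0 := norm_ne_zero_iff.2 hv.2
  refine ⟨(‖v‖⁻¹ : ℂ) • v, μ⁻¹, ?_, ?_, ?_⟩
  · rw [norm_smul]; simp [hv0]
  · rw [map_smul, hv2, smul_comm]
  · rw [norm_inv]; exact inv_anti₀ hε hμε

theorem mem_opSpectrum_of_eigenvector {H : Type*} [NormedAddCommGroup H] [InnerProductSpace ℂ H]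
    {T : H →ₗ.[ℂ] H} {z : ℂ} {x : T.domain} (hx : T x = z • (x : H)) (hx0 : (x : H) ≠ 0) :
    z ∈ opSpectrum T := by
  rintro ⟨R, hR, -⟩
  have := hR x
  rw [hx, sub_self, map_zero] at this
  exact hx0 this.symm

theorem orthonormal_single {φ : ℕ → ℕ} (hφ : Function.Injective φ)
    {v : ℕ → EuclideanSpace ℂ (Fin p)} (hv : ∀ k, ‖v k‖ = 1) :
    Orthonormal ℂ fun k => (lp.single 2 (φ k) (v k) : L2 p) := by
  refine ⟨fun k => by rw [lp.norm_single (by simp), hv], fun k l hkl => ?_⟩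
  change inner ℂ (lp.single 2 (φ k) (v k) : L2 p) (lp.single 2 (φ l) (v l) : L2 p) = 0
  rw [lp.inner_single_left, lp.single_apply_ne _ _ _ (hφ.ne hkl), inner_zero_right]

/-- Otherwise infinitely many blocks have an eigenvalue in one fixed disc. A limit point of these
eigenvalues lies in the spectrum and is either not isolated or of infinite multiplicity. -/
theorem HasDiscreteSpectrum.tendsto_norm_op_inv (h : HasDiscreteSpectrum (diagOp A))
    (hA : ∀ n, (A n).IsHermitian) (hdet : ∀ n, IsUnit (A n).det) :
    Tendsto (fun n => ‖op (A n)⁻¹‖) atTop (𝓝 0) := by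
  by_contra hcon
  obtain ⟨ε, hε, hfreq⟩ : ∃ ε > 0, ∃ᶠ n in atTop, ε ≤ ‖op (A n)⁻¹‖ := by
    by_contra! hc
    refine hcon (tendsto_order.2 ⟨fun a ha => Eventually.of_forall fun n =>
      ha.trans_le (norm_nonneg _), fun a ha => ?_⟩)
    have := hc a ha
    simpa using this
  obtain ⟨φ, hφ, hφε⟩ := extraction_of_frequently_atTop hfreq
  choose v z hv hAv hz using fun k =>
    exists_eigenvector_of_le_norm_op_inv (hA (φ k)) (hdet (φ k)) hε (hφε k)
  obtain ⟨w, -, ψ, hψ, hw⟩ := tendsto_subseq_of_bounded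
    (Metric.isBounded_closedBall (x := (0 : ℂ)) (r := ε⁻¹)) (x := z)
    fun k => by simpa using hz k
  have horth := orthonormal_single (φ := fun k => φ (ψ k)) (v := fun k => v (ψ k))
    (hφ.comp hψ).injective fun k => hv (ψ k)
  set x : ℕ → (diagOp A).domain := fun k =>
    ⟨lp.single 2 (φ (ψ k)) (v (ψ k)), single_mem_diagOp_domain _ _⟩ with hxdef
  have hx : ∀ k, diagOp A (x k) = z (ψ k) • (x k : L2 p) := fun k => by
    rw [hxdef, diagOp_single, hAv, lp.single_smul]
  have hx1 : ∀ k, ‖(x k : L2 p)‖ = 1 := horth.1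
  have hx0 : ∀ k, (x k : L2 p) ≠ 0 := fun k => norm_ne_zero_iff.1 (by rw [hx1]; exact one_ne_zero)
  -- The unit vectors `x k` form a Weyl sequence: `‖(𝒜 - w) x k‖ = |z (ψ k) - w| → 0`.
  have hwmem : w ∈ opSpectrum (diagOp A) := by
    rintro ⟨R, hR, -⟩
    have hle : ∀ k, 1 ≤ ‖R‖ * ‖z (ψ k) - w‖ := fun k => by
      have h1 := hR (x k)
      rw [hx, ← sub_smul] at h1
      have h2 := R.le_opNorm ((z (ψ k) - w) • (x k : L2 p))
      rwa [h1, norm_smul, hx1, mul_one] at h2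
    have hlim : Tendsto (fun k => ‖R‖ * ‖z (ψ k) - w‖) atTop (𝓝 (‖R‖ * 0)) :=
      (tendsto_iff_norm_sub_tendsto_zero.1 hw).const_mul _
    have := ge_of_tendsto' hlim hle
    rw [mul_zero] at this
    linarith
  obtain ⟨⟨δ, hδ, hball⟩, -, hfin⟩ := h w hwmem
  obtain ⟨K, hK⟩ := Metric.tendsto_atTop.1 hw δ hδ
  have hzw : ∀ k, z (ψ (k + K)) = w := fun k => by
    have : z (ψ (k + K)) ∈ opSpectrum (diagOp A) ∩ Metric.ball w δ :=
      ⟨mem_opSpectrum_of_eigenvector (hx _) (hx0 _), hK (k + K) (by omega)⟩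
    rw [hball] at this
    exact this
  let e : ℕ → eigenspace (diagOp A) w := fun k =>
    ⟨x (k + K), mem_eigenspace.2 (by rw [hx, hzw])⟩
  have hli : LinearIndependent ℂ e := by
    refine LinearIndependent.of_comp
      ((diagOp A).domain.subtype.comp (eigenspace (diagOp A) w).subtype) ?_
    exact (horth.comp (fun k => k + K) (add_left_injective K)).linearIndependent
  have := hli.finite_of_isNoetherian
  exact not_finite ℕ

/-- The truncations to finitely many blocks have finite rank and converge to `R` in norm. -/
theorem isCompactOperator_of_tendsto_norm_op {M : ℕ → Matrix (Fin p) (Fin p) ℂ}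
    (hM : Tendsto (fun n => ‖op (M n)‖) atTop (𝓝 0)) {R : L2 p →L[ℂ] L2 p}
    (hR : ∀ f n, R f n = op (M n) (f n)) : IsCompactOperator R := by
  let S : ℕ → L2 p →L[ℂ] L2 p := fun n =>
    (lp.singleContinuousLinearMap ℂ (fun _ : ℕ => EuclideanSpace ℂ (Fin p)) 2 n).comp
      ((op (M n)).comp (lp.evalCLM ℂ (fun _ : ℕ => EuclideanSpace ℂ (Fin p)) 2 n))
  have hS : ∀ n, IsCompactOperator (S n) := fun n =>
    (isCompactOperator_of_locallyCompactSpace_rng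
      (lp.singleContinuousLinearMap ℂ (fun _ : ℕ => EuclideanSpace ℂ (Fin p)) 2 n)).comp_clm _
  have hSapply : ∀ n f, S n f = lp.single 2 n (op (M n) (f n)) := fun n f => rfl
  have hF : ∀ k, IsCompactOperator (∑ n ∈ Finset.range k, S n : L2 p →L[ℂ] L2 p) := fun k =>
    (compactOperator (RingHom.id ℂ) (L2 p) (L2 p)).sum_mem fun n _ => hS n
  refine isCompactOperator_of_tendsto (l := atTop) ?_ (Eventually.of_forall hF)
  rw [Metric.tendsto_atTop]
  intro ε hε
  obtain ⟨K, hK⟩ := Metric.tendsto_atTop.1 hM (ε / 2) (by positivity)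
  refine ⟨K, fun k hk => ?_⟩
  rw [dist_comm, dist_eq_norm]
  refine lt_of_le_of_lt (ContinuousLinearMap.opNorm_le_bound _ (by positivity : 0 ≤ ε / 2)
    fun f => ?_) (half_lt_self hε)
  refine norm_le_of_sum_norm_sq_le (by positivity) fun s => ?_
  have hn : ∀ n, ‖((R - ∑ i ∈ Finset.range k, S i) f) n‖ ≤ ε / 2 * ‖f n‖ := fun n => by
    have happ : ((R - ∑ i ∈ Finset.range k, S i) f) n =
        op (M n) (f n) - ∑ i ∈ Finset.range k, (lp.single 2 i (op (M i) (f i)) : L2 p) n := by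
      rw [sub_apply, lp.coeFn_sub, Pi.sub_apply, hR, sum_apply, lp.coeFn_sum,
        Finset.sum_apply]
      simp only [hSapply]
    rw [happ]
    by_cases hnk : n < k
    · rw [Finset.sum_eq_single n]
      · rw [lp.single_apply_self, sub_self, norm_zero]; positivity
      · intro i _ hi
        rw [lp.single_apply_ne _ _ _ hi.symm]
      · simp [hnk]
    · rw [Finset.sum_eq_zero, sub_zero]
      · refine ((op (M n)).le_opNorm _).trans ?_
        have := hK n (by omega)
        rw [dist_zero_right, norm_norm] at this
        gcongr
      · intro i hi
        rw [Finset.mem_range] at hi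
        rw [lp.single_apply_ne _ _ _ (by omega)]
  calc _ ≤ ∑ n ∈ s, (ε / 2) ^ 2 * ‖f n‖ ^ 2 := Finset.sum_le_sum fun n _ => by
        rw [← mul_pow]
        exact pow_le_pow_left₀ (norm_nonneg _) (hn n) 2
    _ ≤ (ε / 2 * ‖f‖) ^ 2 := by
        rw [← Finset.mul_sum, mul_pow]
        exact mul_le_mul_of_nonneg_left (sum_norm_sq_le f s) (sq_nonneg _)

theorem HasDiscreteSpectrum.exists_compact_inverse (h : HasDiscreteSpectrum (diagOp A))
    (hA : ∀ n, (A n).IsHermitian) (hker : LinearMap.ker (diagOp A).toFun = ⊥) :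
    InvMemSchatten ∞ (diagOp A) := by
  have hdet := isUnit_det_of_ker_diagOp hker
  have hres : ∃ R, IsInverseAt (diagOp A) 0 R := by
    by_contra hc
    -- Spectral points are eigenvalues, and 0 is not an eigenvalue.
    exact (h 0 hc).2.1 (by rw [← ker_eq_eigenspace_zero, hker])
  obtain ⟨R, hR⟩ := hres
  refine ⟨R, hR, ?_⟩
  rw [MemSchatten, if_pos rfl]
  exact isCompactOperator_of_tendsto_norm_op (h.tendsto_norm_op_inv hA hdet)
    (inverse_diagOp_apply hdet hR)

end Diagonal

end BlockJacobi

end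

/-! ### Selfadjointness, Schatten resolvents and discrete spectrum of `J` -/

open BlockJacobi
theorem theorem3p2 (p : ℕ) (A B : ℕ → Matrix (Fin p) (Fin p) ℂ)
    (hA : ∀ n, (A n).IsHermitian) (hB : ∀ n, IsUnit (B n).det)
    (hker : LinearMap.ker (diagOp A).toFun = ⊥)
    (hcond : ∃ N, CondI A B N ∨ CondII A B N ∨ CondIII A B N ∨ CondIV A B N ∨ CondV A B N) :
    (∀ q : ℝ≥0∞, 0 < q → InvMemSchatten q (diagOp A) →
      IsSelfAdjoint (jacobi A B) ∧
      (∀ z : ℂ, eigenspace (jacobi A B) z = ⊥ → ResolventMemSchatten q (jacobi A B) z) ∧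
      (LinearMap.ker (jacobi A B).toFun = ⊥ → InvMemSchatten q (jacobi A B)) ∧
      (CondI A B 0 ∨ CondII A B 0 ∨ CondIII A B 0 ∨ CondV A B 0 →
        InvMemSchatten q (jacobi A B))) ∧
    (HasDiscreteSpectrum (diagOp A) →
      IsSelfAdjoint (jacobi A B) ∧ HasDiscreteSpectrum (jacobi A B)) := by
  have hdet := isUnit_det_of_ker_diagOp hker
  obtain ⟨N, hN⟩ := hcond
  have hlt : a₁ A B N < 1 ∨ a₂ A B N < 1 := by
    rcases hN with h | h | h | h | h
    · exact h.a₁_lt_one_or_a₂_lt_one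
    · exact h.condI.a₁_lt_one_or_a₂_lt_one
    · exact Or.inl h.a₁_lt_one
    · exact Or.inr h.a₂_lt_one
    · exact Or.inl h.a₁_lt_one
  have main : ∀ q : ℝ≥0∞, 0 < q → InvMemSchatten q (diagOp A) → IsSelfAdjoint (jacobi A B) ∧
      ∀ z : ℂ, eigenspace (jacobi A B) z = ⊥ → ResolventMemSchatten q (jacobi A B) z := by
    rintro q hq ⟨R₀, hR₀, hR₀q⟩
    obtain ⟨R, W, hW, h₁, h₂, hRq⟩ :=
      exists_isInverseAt_jacobi_sub hA hdet (inverse_diagOp_apply hdet hR₀) hlt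
    refine ⟨isSelfAdjoint_of_surjective jacobi_dense (jacobi_isFormalAdjoint hA) hW
      fun y => (h₂ y).imp fun _ h => h.2, fun z hz => ?_⟩
    obtain ⟨G, hG⟩ := exists_isInverseAt_of_isCompactOperator h₁ h₂
      ((hRq q hR₀q).isCompactOperator hq) hz
    exact ⟨_, hG, (hRq q hR₀q).mul_right G⟩
  refine ⟨fun q hq hinv => ?_, fun hdisc => ?_⟩
  · obtain ⟨hsa, hres⟩ := main q hq hinv
    have hzero : LinearMap.ker (jacobi A B).toFun = ⊥ → InvMemSchatten q (jacobi A B) :=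
      fun h => hres 0 (by rw [← ker_eq_eigenspace_zero, h])
    refine ⟨hsa, hres, hzero, fun h0 => ?_⟩
    have hI : CondI A B 0 → InvMemSchatten q (jacobi A B) := fun h => hzero <| by
      rw [Submodule.eq_bot_iff]
      intro x hx
      refine Subtype.ext (h.eq_zero_of_row_eq_zero hdet fun n => ?_)
      have hx : jacobi A B x = 0 := hx
      rw [← jacobi_apply hA, hx]
      rfl
    -- No cutoff is needed, as every row of `K` is controlled. The analogue for `a₂(0) < 1` fails at
    -- row 0 of `L`, since `‖A₁⁻¹ B₀*‖` does not occur in `a₂(0)`.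
    have hlt1 : a₁ A B 0 < 1 → InvMemSchatten q (jacobi A B) := fun h => by
      obtain ⟨R₀, hR₀, hR₀q⟩ := hinv
      have hC : (a₁ A B 0).toReal < 1 := by
        simpa using ENNReal.toReal_strict_mono ENNReal.one_ne_top h
      obtain ⟨G, hG⟩ := exists_isInverseAt_of_rows hA hdet (inverse_diagOp_apply hdet hR₀) hC
        fun n => by
          rw [add_comm]
          exact norm_rows_le_toReal_a₁ (h.trans ENNReal.one_lt_top).ne (Nat.zero_le n)
      exact ⟨_, hG, hR₀q.mul_left G⟩
    rcases h0 with h | h | h | h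
    · exact hI h
    · exact hI h.condI
    · exact hlt1 h.a₁_lt_one
    · exact hlt1 h.a₁_lt_one
  · obtain ⟨hsa, hres⟩ := main ∞ ENNReal.zero_lt_top (hdisc.exists_compact_inverse hA hker)
    refine ⟨hsa, hasDiscreteSpectrum_of_isCompactOperator (jacobi_isFormalAdjoint hA) fun z hz => ?_⟩
    obtain ⟨R, hR, hRc⟩ := hres z hz
    rw [MemSchatten, if_pos rfl] at hRc
    exact ⟨R, hR, hRc⟩
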